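/- Let $n \ge 1$. A mechanism $m=(\mathbf x,\mathbf p)$ consists of Borel measurable functions $\mathbf x$ (allocation probabilities) and $\mathbf p$ (payments) of the reported valuations. Let $\mathcal M$ be the set of DSIC mechanisms, that is, those with, for all $\mathbf v\in[0,1]^n$, all $i$ and all $\hat v_i\in[0,1]$: $x_i(\mathbf v)\in[0,1]$, $v_i x_i(\mathbf v)-p_i(\mathbf v)\ge 0$, $v_i x_i(\mathbf v)-p_i(\mathbf v)\ge v_i x_i(\hat v_i,\mathbf v_{-i})-p_i(\hat v_i,\mathbf v_{-i})$ and $\sum_i x_i(\mathbf v)\le 1$. For a distribution $\mathbf F$ on $[0,1]^n$ let $$R_n(m,\mathbf F)=\mathbb E_{\mathbf v\sim\mathbf F}\Big[\max(\mathbf v)-\sum_{i=1}^n p_i(\mathbf v)\Big]\in[0,\infty],\qquad \mathcal R_n^*(\mathcal F)=\inf_{m\in\mathcal M}\ \sup_{\mathbf F\in\mathcal F}R_n(m,\mathbf F).$$ Let $\mathcal F_{\mathrm{iid}}$ be the class of laws of $n$ i.i.d. valuations in $[0,1]$, and $\mathcal F_{\mathrm{aff}}$ the class of probability distributions on $[0,1]^n$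 that are exchangeable (invariant under permutations of the coordinates) and affiliated: $\Pr_{\mathbf F}(A\cap B\mid S)\ge \Pr_{\mathbf F}(A\mid S)\Pr_{\mathbf F}(B\mid S)$ for all Borel increasing sets $A,B\subseteq\mathbb R^n$ and every Borel sublattice $S\subseteq\mathbb R^n$ (under componentwise min and max) with $\Pr_{\mathbf F}(S)>0$. For a probability distribution $\Phi$ of a reserve price, $\mathrm{SPA}(\Phi)$ denotes the second-price auction with random reserve $p\sim\Phi$: if the highest bid $v^{(1)}$ is at least $p$, a highest bidder (ties broken by any measurable, possibly randomized rule) gets the item and pays $\max(v^{(2)},p)$, where $v^{(2)}$ is the second-highest bid ($v^{(2)}=0$ if $n=1$); otherwise nothing is sold or charged. **Proposition.** There is exactly one $r_n^*\in(0,1/n)$ with $$(1-r_n^*)^{n-1}+\log r_n^*+\sum_{k=1}^{n-1}\frac{(1-r_n^*)^k}{k}=0 .$$ The function equal to $0$ on $(-\infty,r_n^*]$, to $1$ on $(1,\infty)$, and to $$\Phi_n^*(v)=\Big(\frac{v}{v-r_n^*}\Big)^{n-1}\log\frac{v}{r_n^*}-\sum_{k=1}^{n-1}\frac1k\Big(\frac{v}{v-r_n^*}\Big)^{n-1-k}$$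 for $v\in(r_n^*,1]$ is the CDF of a probability distribution, and so is the isorevenue function $F_n^*$ given by $F_n^*(v)=0$ for $v\le r_n^*$, $F_n^*(v)=1-r_n^*/v$ for $r_n^*\le v<1$ and $F_n^*(v)=1$ for $v\ge 1$. Let $m_n^*=\mathrm{SPA}(\Phi_n^*)$, with any tie-breaking rule, and let $\mathbf F_n^*$ be the law of $n$ i.i.d. valuations with CDF $F_n^*$. Then $m_n^*\in\mathcal M$, $\mathbf F_n^*\in\mathcal F_{\mathrm{iid}}$, $\mathbf F_n^*\in\mathcal F_{\mathrm{aff}}$, and for every $\mathbf F\in\mathcal F_{\mathrm{aff}}$ and every $m\in\mathcal M$, $$R_n(m_n^*,\mathbf F)\ \le\ R_n(m_n^*,\mathbf F_n^*)\ \le\ R_n(m,\mathbf F_n^*).$$ Consequently $\mathcal R_n^*(\mathcal F_{\mathrm{aff}})=\mathcal R_n^*(\mathcal F_{\mathrm{iid}})$. -/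

import Mathlib

open MeasureTheory ProbabilityTheory

open scoped ENNReal

namespace RegretAuction

/-- A direct mechanism for `n` buyers: allocation probabilities and expected payments, as functions
of the vector of reported valuations. -/
structure Mechanism (n : ℕ) where
  alloc : (Fin n → ℝ) → Fin n → ℝ
  pay : (Fin n → ℝ) → Fin n → ℝ

/-- The valuation vectors, `[0,1]^n`. -/
def Valuations (n : ℕ) : Set (Fin n → ℝ) := Set.Icc 0 1

/-- The (Borel measurable) dominant strategy incentive compatible mechanisms: allocation
probabilities in `[0,1]`, ex-post individual rationality (IR), ex-post incentive compatibility (IC)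
and the allocation constraint (AC), for all valuations in `[0,1]`. -/
structure Mechanism.IsDSIC {n : ℕ} (m : Mechanism n) : Prop where
  measurable_alloc : Measurable m.alloc
  measurable_pay : Measurable m.pay
  alloc_mem : ∀ v ∈ Valuations n, ∀ i, m.alloc v i ∈ Set.Icc (0 : ℝ) 1
  ir : ∀ v ∈ Valuations n, ∀ i, 0 ≤ v i * m.alloc v i - m.pay v i
  ic : ∀ v ∈ Valuations n, ∀ i, ∀ w ∈ Set.Icc (0 : ℝ) 1,
    v i * m.alloc (Function.update v i w) i - m.pay (Function.update v i w) i
      ≤ v i * m.alloc v i - m.pay v i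
  ac : ∀ v ∈ Valuations n, ∑ i, m.alloc v i ≤ 1

/-- The class of all DSIC mechanisms. -/
def dsicMechanisms (n : ℕ) : Set (Mechanism n) := {m | m.IsDSIC}

/-- The highest valuation `max(v)`. -/
noncomputable def maxVal {n : ℕ} (v : Fin n → ℝ) : ℝ := ⨆ i, v i

/-- The expected regret `E_{v ∼ F}[max(v) - ∑ i, p_i(v)]`. For a mechanism satisfying (IR) and (AC)
the integrand is nonnegative on `[0,1]^n`, so the expectation always exists in `[0,∞]` (it is `∞`
exactly when the expected revenue is `-∞`), and it is computed there. -/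
noncomputable def regret {n : ℕ} (m : Mechanism n) (F : Measure (Fin n → ℝ)) : ℝ≥0∞ :=
  ∫⁻ v, ENNReal.ofReal (maxVal v - ∑ i, m.pay v i) ∂F

/-- The minimax regret over a class `C` of distributions of the valuations. -/
noncomputable def minimaxRegret (n : ℕ) (C : Set (Measure (Fin n → ℝ))) : ℝ≥0∞ :=
  ⨅ m ∈ dsicMechanisms n, ⨆ F ∈ C, regret m F

/-- The i.i.d. distributions supported in `[0,1]^n`. -/
def iidClass (n : ℕ) : Set (Measure (Fin n → ℝ)) :=
  {F | ∃ G : Measure ℝ, IsProbabilityMeasure G ∧ G (Set.Icc 0 1) = 1 ∧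
    F = Measure.pi (fun _ : Fin n => G)}

/-- Exchangeability: invariance of the law under all permutations of the coordinates. -/
def Exchangeable {n : ℕ} (F : Measure (Fin n → ℝ)) : Prop :=
  ∀ σ : Equiv.Perm (Fin n), F.map (fun v => v ∘ σ) = F

/-- Affiliation: conditionally on every sublattice (of positive probability), increasing events are
nonnegatively correlated. -/
def Affiliated {n : ℕ} (F : Measure (Fin n → ℝ)) : Prop :=
  ∀ A B S : Set (Fin n → ℝ), MeasurableSet A → MeasurableSet B → MeasurableSet S →
    IsUpperSet A → IsUpperSet B → IsSublattice S → F S ≠ 0 →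
      F[A|S] * F[B|S] ≤ F[A ∩ B|S]

/-- The exchangeable and affiliated distributions supported in `[0,1]^n`. -/
def affClass (n : ℕ) : Set (Measure (Fin n → ℝ)) :=
  {F | IsProbabilityMeasure F ∧ F (Valuations n) = 1 ∧ Exchangeable F ∧ Affiliated F}

/-- The second-highest order statistic of `v` (`Tuple.sort v` sorts `v` in nondecreasing order);
with a single buyer there is no second bid, and it is `0`. -/
noncomputable def secondVal {n : ℕ} (v : Fin n → ℝ) : ℝ :=
  if h : 1 < n then v (Tuple.sort v ⟨n - 2, by omega⟩) else 0

/-- A (possibly randomized) tie-breaking rule: given the bids, the probabilities with which the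
buyers are selected, only highest bidders being selected. -/
structure IsTieBreaking {n : ℕ} (τ : (Fin n → ℝ) → Fin n → ℝ) : Prop where
  measurable : Measurable τ
  nonneg : ∀ v i, 0 ≤ τ v i
  sum_eq_one : ∀ v, ∑ i, τ v i = 1
  highest : ∀ v i, v i ≠ maxVal v → τ v i = 0

/-- The second-price auction with tie-breaking rule `τ` and random reserve price `p ∼ Ψ`: if the
highest bid is at least `p`, the selected highest bidder gets the item and pays
`max(v^{(2)}, p)`. -/
noncomputable def spa {n : ℕ} (τ : (Fin n → ℝ) → Fin n → ℝ) (Ψ : Measure ℝ) : Mechanism n where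
  alloc v i := τ v i * Ψ.real (Set.Iic (maxVal v))
  pay v i := τ v i * ∫ p in Set.Iic (maxVal v), max (secondVal v) p ∂Ψ

/-- `r ∈ (0, 1/n)` solves the equation that determines `r_n^*`. -/
def IsOptimalLevel (n : ℕ) (r : ℝ) : Prop :=
  0 < r ∧ r < 1 / (n : ℝ) ∧
    (1 - r) ^ (n - 1) + Real.log r + ∑ k ∈ Finset.Icc 1 (n - 1), (1 - r) ^ k / (k : ℝ) = 0

/-- The reserve price distribution function `Φ_n^*`, with parameter `r`. It is supported in `[r,1]`,
and its value at `r` is the limit `0` of the displayed formula. -/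
noncomputable def reserveCDF (n : ℕ) (r v : ℝ) : ℝ :=
  if v ≤ r then 0
  else if v ≤ 1 then
    (v / (v - r)) ^ (n - 1) * Real.log (v / r)
      - ∑ k ∈ Finset.Icc 1 (n - 1), 1 / (k : ℝ) * (v / (v - r)) ^ (n - 1 - k)
  else 1

/-- The isorevenue distribution function starting at `r`. -/
noncomputable def isorevenueCDF (r v : ℝ) : ℝ :=
  if v ≤ r then 0 else if v < 1 then 1 - r / v else 1

end RegretAuction

/-!
The pair formed by the second-price auction with reserve distribution `Φ = reserveCDF` and the
product of isorevenue distributions is a saddle point of the regret, which gives the equality of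
the two minimax values (`minimaxRegret_eq_of_saddle`) as soon as product measures are known to be
exchangeable and affiliated (`iidClass_subset_affClass`). Affiliation of product measures is a four
functions theorem on `ℝ ^ n`, by induction on `n` from the case of a linear order
(`four_functions_lintegral`, `four_functions_pi`).

*The reserve distribution.* With `q = 1 - r / v` one has `Φ v = q ^ (1 - n) ∑_{k ≥ n} q ^ k / k`;
the tail of the logarithm series is `logTail`, with derivative `q ^ (n - 1) / (1 - q)`.
Monotonicity, continuity at `r` and all bounds follow from `0 ≤ n * logTail ≤ q ^ n / (1 - q)`, and
the equation for `r` says `Φ 1 = 1`.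

*No mechanism does better against isorevenue valuations.* For fixed competing bids, incentive
compatibility says that the allocation `x` is a subgradient of the utility `U`, so that the payment
is `t ^ 2` times the derivative of `U t / t`. As the isorevenue density is `r / t ^ 2` on `(r, 1)`,
with an atom of mass `r` at `1`, the expected payment of a buyer is exactly `r x(1) - U(r)`
(`IsSubgradient.lintegral_isoMeasure`). Summing over the buyers, no mechanism has a revenue above
the probability of `max(v) = 1`, and the auction, which never reserves below `r` or above `1`,
attains this bound (`regret_spa_le_regret`).

*No exchangeable affiliated distribution is worse for the auction.* A layer-cake formula expresses
the regret of the auction under `F` as the integral over `t ∈ [0, 1)` of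
`ψ'(t) (1 - a) + n Φ(t) (d - a)`, where `ψ(t) = t (1 - Φ(t))`, and `a` and `d` are the probabilities
that all bids, respectively the bids of all but one given buyer, are at most `t`
(`regret_spa_eq`, `integral_layer`). Affiliation and exchangeability give `d ^ n ≤ a ^ (n - 1)`
(`lowProb_pow_le`), with equality for i.i.d. bids. Because `ψ' = Φ ((n - 1) / q - n)` above `r`,
Young's inequality `n q d ≤ q ^ n + (n - 1) a` shows that every layer is largest when
`a = q ^ n` and `d = q ^ (n - 1)`, which are the values for isorevenue valuations
(`integral_layer_le`).
-/

namespace RegretAuction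

open Filter Topology Set

/-! ### The tail of the logarithm series and the optimal level -/

/-- The tail `∑_{k > m} q ^ k / k` of the power series of `-log (1 - q)`, in closed form. With
`q = 1 - r / v` the reserve price distribution function is `logTail m q / q ^ m`. -/
noncomputable def logTail (m : ℕ) (q : ℝ) : ℝ :=
  -Real.log (1 - q) - ∑ j ∈ Finset.range m, q ^ (j + 1) / ((j : ℝ) + 1)

lemma logTail_zero_right (m : ℕ) : logTail m 0 = 0 := by
  simp [logTail]

lemma hasDerivAt_logTail (m : ℕ) {q : ℝ} (hq : q < 1) :
    HasDerivAt (logTail m) (q ^ m / (1 - q)) q := by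
  have h1 : (1 - q) ≠ 0 := by linarith
  have hl : HasDerivAt (fun q : ℝ => -Real.log (1 - q)) (1 / (1 - q)) q := by
    refine (((hasDerivAt_id q).const_sub 1).log h1).neg.congr_deriv ?_
    simp [neg_div]
  have hs : HasDerivAt (fun q : ℝ => ∑ j ∈ Finset.range m, q ^ (j + 1) / ((j : ℝ) + 1))
      (∑ j ∈ Finset.range m, q ^ j) q := by
    apply HasDerivAt.fun_sum
    intro j _
    refine ((hasDerivAt_pow (j + 1) q).div_const ((j : ℝ) + 1)).congr_deriv ?_
    have : (j : ℝ) + 1 ≠ 0 := by positivity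
    push_cast
    field_simp
  refine (hl.sub hs).congr_deriv ?_
  rw [geom_sum_eq hq.ne]
  have : q - 1 ≠ 0 := by linarith
  field_simp
  ring

lemma continuousOn_logTail (m : ℕ) : ContinuousOn (logTail m) (Iio 1) := fun _ hq =>
  (hasDerivAt_logTail m hq).continuousAt.continuousWithinAt

lemma logTail_nonneg (m : ℕ) {q : ℝ} (h0 : 0 ≤ q) (h1 : q < 1) : 0 ≤ logTail m q := by
  have hmono : MonotoneOn (logTail m) (Ico 0 1) := by
    apply monotoneOn_of_deriv_nonneg (convex_Ico 0 1)
    · exact (continuousOn_logTail m).mono fun x hx => hx.2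
    · intro x hx
      rw [interior_Ico] at hx
      exact (hasDerivAt_logTail m hx.2).differentiableAt.differentiableWithinAt
    · intro x hx
      rw [interior_Ico] at hx
      rw [(hasDerivAt_logTail m hx.2).deriv]
      exact div_nonneg (pow_nonneg hx.1.le m) (by linarith [hx.2])
  have := hmono (left_mem_Ico.2 one_pos) ⟨h0, h1⟩ h0
  rwa [logTail_zero_right] at this

lemma succ_mul_logTail_le (m : ℕ) {q : ℝ} (h0 : 0 ≤ q) (h1 : q < 1) :
    ((m : ℝ) + 1) * logTail m q ≤ q ^ (m + 1) / (1 - q) := by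
  have hd : ∀ x : ℝ, x < 1 →
      HasDerivAt (fun x : ℝ => x ^ (m + 1) / (1 - x) - ((m : ℝ) + 1) * logTail m x)
        (x ^ (m + 1) / (1 - x) ^ 2) x := by
    intro x hx
    have hx' : 1 - x ≠ 0 := by linarith
    refine (((hasDerivAt_pow (m + 1) x).div ((hasDerivAt_id x).const_sub 1) hx').sub
      ((hasDerivAt_logTail m hx).const_mul ((m : ℝ) + 1))).congr_deriv ?_
    simp
    field_simp
    ring
  have hmono : MonotoneOn
      (fun x : ℝ => x ^ (m + 1) / (1 - x) - ((m : ℝ) + 1) * logTail m x) (Ico 0 1) := by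
    apply monotoneOn_of_deriv_nonneg (convex_Ico 0 1)
    · exact fun x hx => (hd x hx.2).continuousAt.continuousWithinAt
    · intro x hx
      rw [interior_Ico] at hx
      exact (hd x hx.2).differentiableAt.differentiableWithinAt
    · intro x hx
      rw [interior_Ico] at hx
      rw [(hd x hx.2).deriv]
      exact div_nonneg (pow_nonneg hx.1.le _) (sq_nonneg _)
  have := hmono (left_mem_Ico.2 one_pos) ⟨h0, h1⟩ h0
  simp only [logTail_zero_right] at this
  simp at this
  linarith

lemma sum_Icc_one_eq_sum_range (m : ℕ) (f : ℕ → ℝ) :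
    ∑ k ∈ Finset.Icc 1 m, f k = ∑ j ∈ Finset.range m, f (j + 1) := by
  induction m with
  | zero => simp
  | succ m ih => rw [Finset.sum_Icc_succ_top (by omega), Finset.sum_range_succ, ih]

/-- The equation for the optimal level says that the reserve price distribution function reaches
`1` at `v = 1`. -/
lemma isOptimalLevel_succ_iff (m : ℕ) (r : ℝ) :
    IsOptimalLevel (m + 1) r ↔
      0 < r ∧ r < 1 / ((m : ℝ) + 1) ∧ (1 - r) ^ m - logTail m (1 - r) = 0 := by
  unfold IsOptimalLevel logTail
  rw [show m + 1 - 1 = m from rfl, sum_Icc_one_eq_sum_range]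
  push_cast
  rw [sub_sub_cancel, sub_sub_eq_add_sub, sub_neg_eq_add]
  constructor
  · rintro ⟨h1, h2, h3⟩
    exact ⟨h1, h2, by linarith⟩
  · rintro ⟨h1, h2, h3⟩
    exact ⟨h1, h2, by linarith⟩

lemma continuousOn_levelEquation (m : ℕ) :
    ContinuousOn (fun r : ℝ => (1 - r) ^ m - logTail m (1 - r)) (Ioi 0) := by
  refine ContinuousOn.sub (by fun_prop) ((continuousOn_logTail m).comp (by fun_prop) ?_)
  intro r hr
  simp only [mem_Ioi] at hr
  simp only [mem_Iio]
  linarith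

lemma strictMonoOn_levelEquation (m : ℕ) :
    StrictMonoOn (fun r : ℝ => (1 - r) ^ m - logTail m (1 - r)) (Ioo 0 (1 / ((m : ℝ) + 1))) := by
  apply strictMonoOn_of_deriv_pos (convex_Ioo _ _)
  · exact (continuousOn_levelEquation m).mono fun x hx => hx.1
  · intro x hx
    rw [interior_Ioo] at hx
    have hx0 : 0 < x := hx.1
    have hm : (0 : ℝ) < (m : ℝ) + 1 := by positivity
    have hx2 : x * ((m : ℝ) + 1) < 1 := (lt_div_iff₀ hm).1 hx.2
    have hm0 : (0 : ℝ) ≤ m := by positivity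
    have hx1 : 0 < 1 - x := by nlinarith
    have hin : HasDerivAt (fun r : ℝ => 1 - r) (-1) x := by
      simpa using (hasDerivAt_id x).const_sub 1
    have hq : HasDerivAt (logTail m) ((1 - x) ^ m / (1 - (1 - x))) (1 - x) :=
      hasDerivAt_logTail m (by linarith)
    have hd := (hin.pow m).sub (hq.comp x hin)
    have hd' : HasDerivAt (fun r : ℝ => (1 - r) ^ m - logTail m (1 - r))
        ((m : ℝ) * (1 - x) ^ (m - 1) * (-1) - (1 - x) ^ m / (1 - (1 - x)) * (-1)) x := by
      exact hd
    rw [hd'.deriv, sub_sub_cancel]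
    rcases m with _ | k
    · simp [hx0]
    · simp only [Nat.add_sub_cancel]
      have : (((k + 1 : ℕ) : ℝ) * (1 - x) ^ k * (-1) - (1 - x) ^ (k + 1) / x * (-1))
          = (1 - x) ^ k * ((1 - x * (((k + 1 : ℕ) : ℝ) + 1)) / x) := by
        field_simp
        ring
      rw [this]
      exact mul_pos (pow_pos hx1 k) (div_pos (by linarith) hx0)

lemma exists_isOptimalLevel (m : ℕ) : ∃ r, IsOptimalLevel (m + 1) r := by
  simp only [isOptimalLevel_succ_iff]
  have hm : (0 : ℝ) < (m : ℝ) + 1 := by positivity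
  set b : ℝ := 1 / ((m : ℝ) + 1) with hb
  set a : ℝ := Real.exp (-((m : ℝ) + 2)) with ha
  have ha0 : 0 < a := Real.exp_pos _
  have hb0 : 0 < b := by positivity
  have hb1 : b ≤ 1 := by
    rw [hb, div_le_one hm]; linarith [(Nat.cast_nonneg m : (0 : ℝ) ≤ m)]
  have hab : a < b := by
    rw [ha, hb, Real.exp_neg, ← one_div]
    apply one_div_lt_one_div_of_lt hm
    linarith [Real.add_one_le_exp ((m : ℝ) + 2)]
  -- At `a = exp (-(m + 2))` the logarithm outweighs the other `m + 1` summands, each at most `1`.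
  have hfa : (1 - a) ^ m - logTail m (1 - a) ≤ 0 := by
    have h1 : (1 - a) ^ m ≤ 1 := pow_le_one₀ (by linarith) (by linarith)
    have h2 : ∑ j ∈ Finset.range m, (1 - a) ^ (j + 1) / ((j : ℝ) + 1) ≤ m := by
      calc _ ≤ ∑ j ∈ Finset.range m, (1 : ℝ) := by
            apply Finset.sum_le_sum
            intro j _
            rw [div_le_one (by positivity)]
            calc (1 - a) ^ (j + 1) ≤ 1 := pow_le_one₀ (by linarith) (by linarith)
              _ ≤ _ := by linarith [(Nat.cast_nonneg j : (0 : ℝ) ≤ j)]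
        _ = m := by simp
    unfold logTail
    rw [sub_sub_cancel, ha, Real.log_exp, ← ha]
    linarith
  have hfb : 0 < (1 - b) ^ m - logTail m (1 - b) := by
    have h1 := succ_mul_logTail_le m (q := 1 - b) (by linarith) (by linarith)
    rw [sub_sub_cancel, pow_succ] at h1
    have h2 : logTail m (1 - b) ≤ (1 - b) ^ m * (1 - b) := by
      have : (1 - b) ^ m * (1 - b) / b = ((m : ℝ) + 1) * ((1 - b) ^ m * (1 - b)) := by
        rw [hb]; field_simp
      rw [this] at h1
      exact le_of_mul_le_mul_left h1 hm
    have h3 : 0 < (1 - b) ^ m := by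
      rcases m with _ | k
      · simp
      · apply pow_pos
        rw [sub_pos, hb, div_lt_one hm]
        push_cast
        linarith [(Nat.cast_nonneg k : (0 : ℝ) ≤ k)]
    nlinarith
  obtain ⟨r, hr, hr0⟩ := intermediate_value_Ico hab.le
    ((continuousOn_levelEquation m).mono fun x hx => lt_of_lt_of_le ha0 hx.1) ⟨hfa, hfb⟩
  exact ⟨r, ha0.trans_le hr.1, hr.2, hr0⟩

lemma IsOptimalLevel.unique {m : ℕ} {r s : ℝ} (hr : IsOptimalLevel (m + 1) r)
    (hs : IsOptimalLevel (m + 1) s) : s = r := by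
  rw [isOptimalLevel_succ_iff] at hr hs
  exact (strictMonoOn_levelEquation m).injOn ⟨hs.1, hs.2.1⟩ ⟨hr.1, hr.2.1⟩
    (hs.2.2.trans hr.2.2.symm)

/-! ### The reserve price distribution -/

lemma reserveCDF_of_le {n : ℕ} {r v : ℝ} (h : v ≤ r) : reserveCDF n r v = 0 := by
  simp [reserveCDF, h]

lemma reserveCDF_of_mem_Ioc {m : ℕ} {r v : ℝ} (hr : 0 < r) (hv : v ∈ Ioc r 1) :
    reserveCDF (m + 1) r v = logTail m (1 - r / v) / (1 - r / v) ^ m := by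
  have hv0 : 0 < v := hr.trans hv.1
  have hvr : 0 < v - r := sub_pos.2 hv.1
  have hq : 1 - r / v = (v / (v - r))⁻¹ := by field_simp
  have hz : 0 < v / (v - r) := by positivity
  unfold reserveCDF logTail
  rw [if_neg (not_le.2 hv.1), if_pos hv.2, show m + 1 - 1 = m from rfl, sum_Icc_one_eq_sum_range,
    sub_sub_cancel, ← Real.log_inv, inv_div, hq, inv_pow, div_inv_eq_mul, sub_mul,
    Finset.sum_mul, mul_comm]
  congr 1
  apply Finset.sum_congr rfl
  intro j hj
  have hjm : j + 1 ≤ m := Finset.mem_range.1 hj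
  rw [pow_sub₀ _ hz.ne' hjm, inv_pow]
  push_cast
  ring

lemma hasDerivAt_reserveCDF {m : ℕ} {r v : ℝ} (hr : 0 < r) (hv : v ∈ Ioo r 1) :
    HasDerivAt (reserveCDF (m + 1) r)
      (1 / v - m * r / (v * (v - r)) * reserveCDF (m + 1) r v) v := by
  have hv0 : 0 < v := hr.trans hv.1
  have hvr : 0 < v - r := sub_pos.2 hv.1
  have hq0 : 0 < 1 - r / v := by rw [sub_pos, div_lt_one hv0]; exact hv.1
  have hq1 : 1 - r / v < 1 := by simpa using div_pos hr hv0
  have hin : HasDerivAt (fun v : ℝ => 1 - r / v) (r / v ^ 2) v := by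
    refine (((hasDerivAt_inv hv0.ne').const_mul r).const_sub 1).congr_deriv ?_
    ring
  have hq : HasDerivAt (logTail m) _ (1 - r / v) := hasDerivAt_logTail m hq1
  have hd := (hq.comp v hin).div (hin.pow m) (pow_ne_zero m hq0.ne')
  have heq : reserveCDF (m + 1) r =ᶠ[𝓝 v]
      (logTail m ∘ fun v => 1 - r / v) / (fun v => 1 - r / v) ^ m := by
    filter_upwards [Ioo_mem_nhds hv.1 hv.2] with w hw
    exact reserveCDF_of_mem_Ioc hr ⟨hw.1, hw.2.le⟩
  refine (hd.congr_of_eventuallyEq heq).congr_deriv ?_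
  rw [reserveCDF_of_mem_Ioc hr ⟨hv.1, hv.2.le⟩]
  simp only [Function.comp_apply, Pi.pow_apply]
  generalize logTail m (1 - r / v) = H
  have hqv : v - r = v * (1 - r / v) := by field_simp
  rw [sub_sub_cancel, hqv]
  generalize 1 - r / v = q at hq0
  rcases m with _ | k
  · simp
    field_simp
  · simp only [Nat.add_sub_cancel]
    push_cast
    field_simp
    ring

lemma reserveCDF_nonneg_of_mem_Ioc {m : ℕ} {r v : ℝ} (hr : 0 < r) (hv : v ∈ Ioc r 1) :
    0 ≤ reserveCDF (m + 1) r v := by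
  have hv0 : 0 < v := hr.trans hv.1
  have hq0 : 0 < 1 - r / v := by rw [sub_pos, div_lt_one hv0]; exact hv.1
  rw [reserveCDF_of_mem_Ioc hr hv]
  exact div_nonneg (logTail_nonneg m hq0.le (by simpa using div_pos hr hv0)) (by positivity)

lemma succ_mul_reserveCDF_le {m : ℕ} {r v : ℝ} (hr : 0 < r) (hv : v ∈ Ioc r 1) :
    ((m : ℝ) + 1) * r * reserveCDF (m + 1) r v ≤ v - r := by
  have hv0 : 0 < v := hr.trans hv.1
  have hvr : 0 < v - r := sub_pos.2 hv.1
  have hq0 : 0 < 1 - r / v := by rw [sub_pos, div_lt_one hv0]; exact hv.1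
  rw [reserveCDF_of_mem_Ioc hr hv]
  have h := succ_mul_logTail_le m hq0.le (by simpa using div_pos hr hv0)
  rw [sub_sub_cancel, pow_succ, mul_div_assoc] at h
  have h1 : ((m : ℝ) + 1) * logTail m (1 - r / v) / (1 - r / v) ^ m ≤ (1 - r / v) / (r / v) := by
    rw [div_le_iff₀ (by positivity)]
    linarith
  have h2 : (1 - r / v) / (r / v) = (v - r) / r := by field_simp
  rw [h2, le_div_iff₀ hr] at h1
  calc _ = ((m : ℝ) + 1) * logTail m (1 - r / v) / (1 - r / v) ^ m * r := by ring
    _ ≤ _ := h1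

lemma mul_reserveCDF_le {m : ℕ} {r v : ℝ} (hr : 0 < r) (hv : v ∈ Ioc r 1) :
    m * r * reserveCDF (m + 1) r v ≤ v - r := by
  have := succ_mul_reserveCDF_le (m := m) hr hv
  have := mul_nonneg hr.le (reserveCDF_nonneg_of_mem_Ioc (m := m) hr hv)
  nlinarith

section OptimalLevel

variable {m : ℕ} {r : ℝ}

lemma IsOptimalLevel.lt_one (h : IsOptimalLevel (m + 1) r) : r < 1 := by
  rw [isOptimalLevel_succ_iff] at h
  refine h.2.1.trans_le ?_
  rw [div_le_one (by positivity)]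
  linarith [(Nat.cast_nonneg m : (0 : ℝ) ≤ m)]

lemma reserveCDF_one (h : IsOptimalLevel (m + 1) r) : reserveCDF (m + 1) r 1 = 1 := by
  rw [reserveCDF_of_mem_Ioc h.1 ⟨h.lt_one, le_rfl⟩, div_one]
  rw [div_eq_one_iff_eq (pow_ne_zero m (sub_pos.2 h.lt_one).ne')]
  linarith [((isOptimalLevel_succ_iff m r).1 h).2.2]

lemma reserveCDF_of_one_le (h : IsOptimalLevel (m + 1) r) {v : ℝ} (hv : 1 ≤ v) :
    reserveCDF (m + 1) r v = 1 := by
  rcases hv.eq_or_lt with rfl | hv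
  · exact reserveCDF_one h
  · simp [reserveCDF, not_le.2 (h.lt_one.trans hv), not_le.2 hv]

lemma continuous_reserveCDF (h : IsOptimalLevel (m + 1) r) :
    Continuous (reserveCDF (m + 1) r) := by
  have hr := h.1
  -- On `(r, ∞)` the function is a formula in `min v 1`, and at `r` it is squeezed to `0`.
  rw [continuous_iff_continuousAt]
  intro v
  rcases lt_trichotomy v r with hv | hv | hv
  · have : reserveCDF (m + 1) r =ᶠ[𝓝 v] fun _ => 0 := by
      filter_upwards [Iio_mem_nhds hv] with w hw using reserveCDF_of_le (le_of_lt hw)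
    exact continuousAt_const.congr this.symm
  · subst hv
    rw [ContinuousAt, reserveCDF_of_le le_rfl]
    have hlim : Tendsto (fun w : ℝ => |w - v| / ((m + 1) * v)) (𝓝 v) (𝓝 0) := by
      have : Continuous fun w : ℝ => |w - v| / ((m + 1) * v) := by fun_prop
      simpa using this.tendsto v
    apply squeeze_zero_norm' _ hlim
    filter_upwards [Iio_mem_nhds h.lt_one] with w hw
    rcases le_or_gt w v with hwv | hwv
    · rw [reserveCDF_of_le hwv, norm_zero]; positivity
    · have hw' : w ∈ Ioc v 1 := ⟨hwv, le_of_lt hw⟩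
      rw [Real.norm_of_nonneg (reserveCDF_nonneg_of_mem_Ioc hr hw'), le_div_iff₀ (by positivity),
        abs_of_pos (sub_pos.2 hwv)]
      linarith [succ_mul_reserveCDF_le (m := m) hr hw']
  · have heq : reserveCDF (m + 1) r =ᶠ[𝓝 v]
        fun w => logTail m (1 - r / min w 1) / (1 - r / min w 1) ^ m := by
      filter_upwards [Ioi_mem_nhds hv] with w hw
      rcases le_total w 1 with hw1 | hw1
      · rw [min_eq_left hw1, reserveCDF_of_mem_Ioc hr ⟨hw, hw1⟩]
      · rw [min_eq_right hw1, ← reserveCDF_of_mem_Ioc hr ⟨h.lt_one, le_rfl⟩,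
          reserveCDF_of_one_le h hw1, reserveCDF_one h]
    refine ContinuousAt.congr ?_ heq.symm
    have hmin : r < min v 1 := lt_min hv h.lt_one
    have hmin0 : 0 < min v 1 := hr.trans hmin
    have hin : ContinuousAt (fun w : ℝ => 1 - r / min w 1) v := by
      apply ContinuousAt.sub continuousAt_const
      exact ContinuousAt.div continuousAt_const (by fun_prop) hmin0.ne'
    have hq0 : 0 < 1 - r / min v 1 := by rw [sub_pos, div_lt_one hmin0]; exact hmin
    have hq1 : 1 - r / min v 1 < 1 := by simpa using div_pos hr hmin0
    refine ContinuousAt.div ?_ (hin.pow m) (pow_ne_zero m hq0.ne')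
    exact ContinuousAt.comp (g := logTail m) (hasDerivAt_logTail m hq1).continuousAt hin

lemma monotone_reserveCDF (h : IsOptimalLevel (m + 1) r) : Monotone (reserveCDF (m + 1) r) := by
  have hr := h.1
  have hmid : MonotoneOn (reserveCDF (m + 1) r) (Icc r 1) := by
    apply monotoneOn_of_deriv_nonneg (convex_Icc r 1) (continuous_reserveCDF h).continuousOn
    · intro x hx
      rw [interior_Icc] at hx
      exact (hasDerivAt_reserveCDF hr hx).differentiableAt.differentiableWithinAt
    · intro x hx
      rw [interior_Icc] at hx
      have hx0 : 0 < x := hr.trans hx.1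
      have hxr : 0 < x - r := sub_pos.2 hx.1
      rw [(hasDerivAt_reserveCDF hr hx).deriv, sub_nonneg]
      have h1 := mul_reserveCDF_le (m := m) hr ⟨hx.1, hx.2.le⟩
      rw [div_mul_eq_mul_div, div_le_div_iff₀ (by positivity) hx0]
      nlinarith
  -- The function is `clamp to [r, 1]` followed by its monotone restriction.
  have hclamp : ∀ v, reserveCDF (m + 1) r v = reserveCDF (m + 1) r (max r (min v 1)) := by
    intro v
    rcases le_total v r with hv | hv
    · rw [reserveCDF_of_le hv, reserveCDF_of_le]
      exact max_le le_rfl ((min_le_left _ _).trans hv)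
    · rcases le_total v 1 with hv1 | hv1
      · rw [min_eq_left hv1, max_eq_right hv]
      · rw [min_eq_right hv1, max_eq_right h.lt_one.le, reserveCDF_one h,
          reserveCDF_of_one_le h hv1]
  intro a b hab
  rw [hclamp a, hclamp b]
  have hmem : ∀ v : ℝ, max r (min v 1) ∈ Icc r 1 := fun v =>
    ⟨le_max_left _ _, max_le h.lt_one.le (min_le_right _ _)⟩
  exact hmid (hmem a) (hmem b) (max_le_max le_rfl (min_le_min hab le_rfl))

lemma reserveCDF_mem_Icc (h : IsOptimalLevel (m + 1) r) (v : ℝ) :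
    reserveCDF (m + 1) r v ∈ Icc 0 1 := by
  constructor
  · rw [← reserveCDF_of_le (n := m + 1) (min_le_right v r)]
    exact monotone_reserveCDF h (min_le_left v r)
  · rw [← reserveCDF_of_one_le h (le_max_right v 1)]
    exact monotone_reserveCDF h (le_max_left v 1)

lemma exists_measure_cdf_eq_reserveCDF (h : IsOptimalLevel (m + 1) r) :
    ∃ Ψ : Measure ℝ, IsProbabilityMeasure Ψ ∧ ∀ v, cdf Ψ v = reserveCDF (m + 1) r v := by
  let f : StieltjesFunction ℝ :=
    { toFun := reserveCDF (m + 1) r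
      mono' := monotone_reserveCDF h
      right_continuous' := fun x => (continuous_reserveCDF h).continuousWithinAt }
  have h0 : Tendsto f atBot (𝓝 0) := by
    apply tendsto_const_nhds.congr'
    filter_upwards [eventually_le_atBot r] with v hv using (reserveCDF_of_le hv).symm
  have h1 : Tendsto f atTop (𝓝 1) := by
    apply tendsto_const_nhds.congr'
    filter_upwards [eventually_ge_atTop 1] with v hv using (reserveCDF_of_one_le h hv).symm
  refine ⟨f.measure, ⟨?_⟩, fun v => ?_⟩
  · rw [f.measure_univ h0 h1]; simp
  · rw [cdf_measure_stieltjesFunction f h0 h1]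

/-- The derivative of `v ↦ v (1 - Φ v)`, where `Φ` is the reserve price distribution function. It
is the integrand in the layer-cake formula for the regret of the auction that belongs to the event
that the highest bid exceeds `v`. -/
noncomputable def lossDensity (m : ℕ) (r v : ℝ) : ℝ :=
  if v ≤ r then 1 else reserveCDF (m + 1) r v * (m * r / (v - r) - 1)

lemma measurable_lossDensity (h : IsOptimalLevel (m + 1) r) : Measurable (lossDensity m r) := by
  apply Measurable.ite measurableSet_Iic measurable_const
  have := (continuous_reserveCDF h).measurable
  fun_prop

lemma abs_lossDensity_le_one (h : IsOptimalLevel (m + 1) r) (v : ℝ) :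
    |lossDensity m r v| ≤ 1 := by
  unfold lossDensity
  split_ifs with hvr
  · simp
  · rw [not_le] at hvr
    have h1 : m * r * reserveCDF (m + 1) r v ≤ v - r := by
      rcases le_total v 1 with hv | hv
      · exact mul_reserveCDF_le h.1 ⟨hvr, hv⟩
      · have := mul_reserveCDF_le (m := m) h.1 ⟨h.lt_one, le_rfl⟩
        rw [reserveCDF_one h] at this
        rw [reserveCDF_of_one_le h hv]
        linarith
    have h2 := reserveCDF_mem_Icc h v
    have h3 : 0 < v - r := sub_pos.2 hvr
    have h4 : reserveCDF (m + 1) r v * (m * r / (v - r) - 1)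
        = m * r * reserveCDF (m + 1) r v / (v - r) - reserveCDF (m + 1) r v := by ring
    have h5 : m * r * reserveCDF (m + 1) r v / (v - r) ≤ 1 := (div_le_one h3).2 h1
    have h6 : 0 ≤ m * r * reserveCDF (m + 1) r v / (v - r) :=
      div_nonneg (mul_nonneg (mul_nonneg (Nat.cast_nonneg m) h.1.le) h2.1) h3.le
    rw [h4, abs_le]
    constructor <;> linarith [h2.1, h2.2]

lemma integrableOn_lossDensity (h : IsOptimalLevel (m + 1) r) (a b : ℝ) :
    IntegrableOn (lossDensity m r) (Ioc a b) := by
  apply Measure.integrableOn_of_bounded (M := 1) (by simp)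
    (measurable_lossDensity h).aestronglyMeasurable
  exact Eventually.of_forall fun v => abs_lossDensity_le_one h v

/-- The fundamental theorem of calculus for `v ↦ v (1 - Φ v)`, which has a kink at `r`. -/
lemma integral_lossDensity (h : IsOptimalLevel (m + 1) r) {y : ℝ} (hy0 : 0 ≤ y) (hy1 : y ≤ 1) :
    ∫ t in Ico 0 y, lossDensity m r t = y * (1 - reserveCDF (m + 1) r y) := by
  have := integral_eq_of_hasDerivAt_off_countable_of_le
    (fun v => v * (1 - reserveCDF (m + 1) r v)) (lossDensity m r) hy0
    (countable_singleton r) ?_ ?_ ?_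
  · rw [intervalIntegral.integral_of_le hy0, integral_Ioc_eq_integral_Ioo,
      ← integral_Ico_eq_integral_Ioo] at this
    simpa using this
  · have := continuous_reserveCDF h
    fun_prop
  · rintro x ⟨⟨hx0, hx1⟩, hxr⟩
    rcases lt_or_gt_of_ne (show x ≠ r from hxr) with hxr | hxr
    · have : (fun v => v * (1 - reserveCDF (m + 1) r v)) =ᶠ[𝓝 x] id := by
        filter_upwards [Iio_mem_nhds hxr] with w hw
        rw [reserveCDF_of_le (le_of_lt hw)]
        simp
      rw [lossDensity, if_pos hxr.le]
      exact (hasDerivAt_id x).congr_of_eventuallyEq this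
    · have hxv : 0 < x - r := sub_pos.2 hxr
      have hd := hasDerivAt_reserveCDF (m := m) h.1 ⟨hxr, hx1.trans_le hy1⟩
      refine ((hasDerivAt_id x).mul (hd.const_sub 1)).congr_deriv ?_
      rw [lossDensity, if_neg (not_le.2 hxr)]
      simp only [id]
      field_simp
      ring
  · rw [intervalIntegrable_iff, uIoc_of_le hy0]
    exact integrableOn_lossDensity h 0 y

end OptimalLevel

/-! ### The isorevenue distribution -/

/-- The isorevenue distribution: density `r / t ^ 2` on `(r, 1)` and an atom of mass `r` at `1`. -/
noncomputable def isoMeasure (r : ℝ) : Measure ℝ :=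
  (volume.restrict (Ioo r 1)).withDensity (fun t => ENNReal.ofReal (r / t ^ 2))
    + ENNReal.ofReal r • Measure.dirac 1

lemma lintegral_isoMeasure (r : ℝ) {f : ℝ → ℝ≥0∞} (hf : Measurable f) :
    ∫⁻ t, f t ∂(isoMeasure r)
      = (∫⁻ t in Ioo r 1, ENNReal.ofReal (r / t ^ 2) * f t) + ENNReal.ofReal r * f 1 := by
  have hm : Measurable fun t : ℝ => ENNReal.ofReal (r / t ^ 2) := by fun_prop
  rw [isoMeasure, lintegral_add_measure, lintegral_smul_measure, lintegral_dirac' _ hf,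
    lintegral_withDensity_eq_lintegral_mul _ hm hf]
  rfl

lemma lintegral_Ioo_isoDensity {r v : ℝ} (hr : 0 < r) (hv : r ≤ v) :
    ∫⁻ t in Ioo r v, ENNReal.ofReal (r / t ^ 2) = ENNReal.ofReal (1 - r / v) := by
  have hpos : ∀ t ∈ uIcc r v, 0 < t := fun t ht => by
    rw [uIcc_of_le hv] at ht; exact hr.trans_le ht.1
  have hcont : ContinuousOn (fun t : ℝ => r / t ^ 2) (uIcc r v) := by
    apply ContinuousOn.div (by fun_prop) (by fun_prop)
    intro t ht
    exact pow_ne_zero 2 (hpos t ht).ne'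
  have hint : ∫ t in r..v, r / t ^ 2 = 1 - r / v := by
    rw [intervalIntegral.integral_eq_sub_of_hasDerivAt (f := fun t => -(r / t))]
    · field_simp
      ring
    · intro t ht
      refine (((hasDerivAt_inv (hpos t ht).ne').const_mul r).neg).congr_deriv ?_
      ring
    · exact hcont.intervalIntegrable
  rw [← hint, intervalIntegral.integral_of_le hv, integral_Ioc_eq_integral_Ioo,
    ofReal_integral_eq_lintegral_ofReal]
  · exact (intervalIntegrable_iff_integrableOn_Ioo_of_le hv).1 hcont.intervalIntegrable
  · exact Eventually.of_forall fun t => by positivity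

lemma isoMeasure_apply (r : ℝ) {s : Set ℝ} (hs : MeasurableSet s) :
    isoMeasure r s = (∫⁻ t in s ∩ Ioo r 1, ENNReal.ofReal (r / t ^ 2))
      + ENNReal.ofReal r * s.indicator 1 1 := by
  rw [isoMeasure, Measure.add_apply, withDensity_apply _ hs, Measure.restrict_restrict hs,
    Measure.smul_apply, Measure.dirac_apply' _ hs, smul_eq_mul]

lemma isoMeasure_Icc {r : ℝ} (hr : 0 < r) (hr1 : r < 1) : isoMeasure r (Icc r 1) = 1 := by
  rw [isoMeasure_apply r measurableSet_Icc, inter_eq_right.2 Ioo_subset_Icc_self,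
    lintegral_Ioo_isoDensity hr hr1.le, indicator_of_mem (right_mem_Icc.2 hr1.le), Pi.one_apply,
    mul_one, ← ENNReal.ofReal_add (by simpa using hr1.le) hr.le]
  simp

lemma isProbabilityMeasure_isoMeasure {r : ℝ} (hr : 0 < r) (hr1 : r < 1) :
    IsProbabilityMeasure (isoMeasure r) := by
  refine ⟨?_⟩
  rw [isoMeasure_apply r MeasurableSet.univ, univ_inter, lintegral_Ioo_isoDensity hr hr1.le,
    indicator_univ, Pi.one_apply, mul_one, ← ENNReal.ofReal_add (by simpa using hr1.le) hr.le]
  simp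

lemma isoMeasure_Iic {r : ℝ} (hr : 0 < r) (hr1 : r < 1) (v : ℝ) :
    isoMeasure r (Iic v) = ENNReal.ofReal (isorevenueCDF r v) := by
  have := isProbabilityMeasure_isoMeasure hr hr1
  unfold isorevenueCDF
  split_ifs with h1 h2
  · rw [isoMeasure_apply r measurableSet_Iic,
      show Iic v ∩ Ioo r 1 = ∅ from ?_, indicator_of_notMem]
    · simp
    · simpa using h1.trans_lt hr1
    · ext t
      simp only [mem_inter_iff, mem_Iic, mem_Ioo, mem_empty_iff_false, iff_false]
      rintro ⟨h3, h4, -⟩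
      linarith
  · rw [not_le] at h1
    rw [isoMeasure_apply r measurableSet_Iic,
      show Iic v ∩ Ioo r 1 = Ioc r v from ?_, indicator_of_notMem,
      setLIntegral_congr Ioo_ae_eq_Ioc.symm,
      lintegral_Ioo_isoDensity hr h1.le]
    · simp
    · simpa using h2
    · ext t
      simp only [mem_inter_iff, mem_Iic, mem_Ioo, mem_Ioc]
      constructor
      · rintro ⟨h3, h4, -⟩
        exact ⟨h4, h3⟩
      · rintro ⟨h3, h4⟩
        exact ⟨h4, h3, h4.trans_lt h2⟩
  · rw [not_lt] at h2
    refine le_antisymm (by simpa using prob_le_one) ?_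
    rw [ENNReal.ofReal_one, ← isoMeasure_Icc hr hr1]
    exact measure_mono fun t ht => ht.2.trans h2

lemma cdf_isoMeasure {r : ℝ} (hr : 0 < r) (hr1 : r < 1) (v : ℝ) :
    cdf (isoMeasure r) v = isorevenueCDF r v := by
  have := isProbabilityMeasure_isoMeasure hr hr1
  rw [cdf_eq_real, measureReal_def, isoMeasure_Iic hr hr1, ENNReal.toReal_ofReal]
  unfold isorevenueCDF
  split_ifs with h1 h2
  · exact le_rfl
  · rw [sub_nonneg, div_le_one (hr.trans (not_le.1 h1))]
    exact (not_le.1 h1).le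
  · exact zero_le_one

/-! ### One buyer against the isorevenue distribution -/

section OneBuyer

variable {x U : ℝ → ℝ}

/-- `x t` is a subgradient at `t` of the utility `U` on `[0,1]`, which is incentive compatibility
for one buyer whose competitors' bids are fixed. -/
def IsSubgradient (x U : ℝ → ℝ) : Prop :=
  ∀ s ∈ Icc (0 : ℝ) 1, ∀ t ∈ Icc (0 : ℝ) 1, U t + x t * (s - t) ≤ U s

lemma IsSubgradient.monotoneOn (h : IsSubgradient x U) : MonotoneOn x (Icc 0 1) := by
  intro s hs t ht hst
  rcases hst.eq_or_lt with rfl | hst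
  · exact le_rfl
  · have h1 := h s hs t ht
    have h2 := h t ht s hs
    by_contra hlt
    rw [not_le] at hlt
    nlinarith

lemma IsSubgradient.abs_sub_le (h : IsSubgradient x U) (hx : ∀ t ∈ Icc (0 : ℝ) 1, x t ∈ Icc 0 1)
    {s t : ℝ} (hs : s ∈ Icc (0 : ℝ) 1) (ht : t ∈ Icc (0 : ℝ) 1) : |U s - U t| ≤ |s - t| := by
  have h1 := h s hs t ht
  have h2 := h t ht s hs
  have h3 : |x t * (s - t)| ≤ |s - t| := by
    rw [abs_mul, abs_of_nonneg (hx t ht).1]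
    exact mul_le_of_le_one_left (abs_nonneg _) (hx t ht).2
  have h4 : |x s * (t - s)| ≤ |s - t| := by
    rw [abs_mul, abs_of_nonneg (hx s hs).1, abs_sub_comm t s]
    exact mul_le_of_le_one_left (abs_nonneg _) (hx s hs).2
  rw [abs_le] at h3 h4 ⊢
  constructor <;> linarith

lemma IsSubgradient.continuousOn (h : IsSubgradient x U)
    (hx : ∀ t ∈ Icc (0 : ℝ) 1, x t ∈ Icc 0 1) : ContinuousOn U (Icc 0 1) := by
  have : LipschitzOnWith 1 U (Icc 0 1) := by
    apply LipschitzOnWith.of_dist_le_mul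
    intro s hs t ht
    simpa [Real.dist_eq] using h.abs_sub_le hx hs ht
  exact this.continuousOn

lemma IsSubgradient.hasDerivAt (h : IsSubgradient x U) {t : ℝ} (ht : t ∈ Ioo (0 : ℝ) 1)
    (hc : ContinuousAt x t) : HasDerivAt U (x t) t := by
  rw [hasDerivAt_iff_isLittleO, Asymptotics.isLittleO_iff]
  intro c hc0
  have h1 : ∀ᶠ s in 𝓝 t, |x s - x t| < c := by
    have := Metric.tendsto_nhds.1 hc c hc0
    simpa [Real.dist_eq] using this
  filter_upwards [h1, Ioo_mem_nhds ht.1 ht.2] with s hs hs01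
  have ht' := Ioo_subset_Icc_self ht
  have hs' := Ioo_subset_Icc_self hs01
  have h2 := h s hs' t ht'
  have h3 := h t ht' s hs'
  have h4 : |(x s - x t) * (s - t)| ≤ c * |s - t| := by
    rw [abs_mul]
    exact mul_le_mul_of_nonneg_right hs.le (abs_nonneg _)
  simp only [Real.norm_eq_abs, smul_eq_mul]
  rw [abs_le] at h4 ⊢
  constructor
  · nlinarith [mul_nonneg hc0.le (abs_nonneg (s - t))]
  · nlinarith [h4.2]

/-- The payment is `t ^ 2` times the derivative of `U t / t`. -/
lemma IsSubgradient.integral_eq (h : IsSubgradient x U) (hxm : Measurable x)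
    (hx : ∀ t ∈ Icc (0 : ℝ) 1, x t ∈ Icc 0 1) {r : ℝ} (hr : 0 < r) (hr1 : r < 1) :
    IntegrableOn (fun t => x t / t) (Ioo r 1) ∧ IntegrableOn (fun t => U t / t ^ 2) (Ioo r 1) ∧
    ∫ t in Ioo r 1, x t / t = (∫ t in Ioo r 1, U t / t ^ 2) + (U 1 - U r / r) := by
  have hsub : Icc r 1 ⊆ Icc 0 1 := Icc_subset_Icc_left hr.le
  have hx_int : IntegrableOn (fun t => x t / t) (Ioo r 1) := by
    apply Measure.integrableOn_of_bounded (M := 1 / r) (by simp)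
      (by fun_prop : Measurable fun t => x t / t).aestronglyMeasurable
    filter_upwards [ae_restrict_mem measurableSet_Ioo] with t ht
    have ht0 : 0 < t := hr.trans ht.1
    have := hx t ⟨ht0.le, ht.2.le⟩
    rw [Real.norm_of_nonneg (div_nonneg this.1 ht0.le)]
    exact div_le_div₀ zero_le_one this.2 hr ht.1.le
  have hUc : ContinuousOn U (Icc r 1) := (h.continuousOn hx).mono hsub
  have hU_int : IntegrableOn (fun t => U t / t ^ 2) (Ioo r 1) := by
    refine (ContinuousOn.integrableOn_Icc ?_).mono_set Ioo_subset_Icc_self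
    exact hUc.div (by fun_prop) fun t ht => pow_ne_zero 2 (hr.trans_le ht.1).ne'
  refine ⟨hx_int, hU_int, ?_⟩
  have hftc := integral_eq_of_hasDerivAt_off_countable_of_le (fun t => U t / t)
    (fun t => x t / t - U t / t ^ 2) hr1.le h.monotoneOn.countable_not_continuousWithinAt
    (hUc.div (by fun_prop) fun t ht => (hr.trans_le ht.1).ne') ?_ ?_
  · rw [intervalIntegral.integral_of_le hr1.le, integral_Ioc_eq_integral_Ioo,
      integral_sub hx_int hU_int, div_one] at hftc
    linarith
  · rintro t ⟨ht, htc⟩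
    have ht0 : 0 < t := hr.trans ht.1
    have hmem : t ∈ Ioo (0 : ℝ) 1 := ⟨ht0, ht.2⟩
    have hc : ContinuousAt x t := by
      by_contra hcon
      refine htc ⟨Ioo_subset_Icc_self hmem, fun hw => hcon ?_⟩
      exact hw.continuousAt (Icc_mem_nhds hmem.1 hmem.2)
    refine ((h.hasDerivAt hmem hc).div (hasDerivAt_id t) ht0.ne').congr_deriv ?_
    simp only [id]
    field_simp
  · rw [intervalIntegrable_iff_integrableOn_Ioo_of_le hr1.le]
    exact hx_int.sub hU_int

/-- Against the isorevenue distribution a buyer's expected payment is `r x(1) - U(r)`: the virtual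
value vanishes on `(r, 1)`. Here the expected payment is the difference of the expected value
`∫ t x(t)` of the allocation and the expected utility. -/
lemma IsSubgradient.lintegral_isoMeasure (h : IsSubgradient x U) (hxm : Measurable x)
    (hUm : Measurable U) (hx : ∀ t ∈ Icc (0 : ℝ) 1, x t ∈ Icc 0 1)
    (hU : ∀ t ∈ Icc (0 : ℝ) 1, 0 ≤ U t) {r : ℝ} (hr : 0 < r) (hr1 : r < 1) :
    (∫⁻ t, ENNReal.ofReal (t * x t) ∂(isoMeasure r)) + ENNReal.ofReal (U r)
      = (∫⁻ t, ENNReal.ofReal (U t) ∂(isoMeasure r)) + ENNReal.ofReal (r * x 1) := by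
  obtain ⟨hxi, hUi, heq⟩ := h.integral_eq hxm hx hr hr1
  have h1 : (1 : ℝ) ∈ Icc (0 : ℝ) 1 := right_mem_Icc.2 zero_le_one
  have hx1 := (hx 1 h1).1
  have hU1 := hU 1 h1
  have hUr := hU r ⟨hr.le, hr1.le⟩
  have hxnn : 0 ≤ᵐ[volume.restrict (Ioo r 1)] fun t => x t / t := by
    filter_upwards [ae_restrict_mem measurableSet_Ioo] with t ht
    exact div_nonneg (hx t ⟨(hr.trans ht.1).le, ht.2.le⟩).1 (hr.trans ht.1).le
  have hUnn : 0 ≤ᵐ[volume.restrict (Ioo r 1)] fun t => U t / t ^ 2 := by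
    filter_upwards [ae_restrict_mem measurableSet_Ioo] with t ht
    exact div_nonneg (hU t ⟨(hr.trans ht.1).le, ht.2.le⟩) (sq_nonneg t)
  have e1 : ∫⁻ t in Ioo r 1, ENNReal.ofReal (r / t ^ 2) * ENNReal.ofReal (t * x t)
      = ENNReal.ofReal (r * ∫ t in Ioo r 1, x t / t) := by
    rw [← integral_const_mul, ofReal_integral_eq_lintegral_ofReal (hxi.const_mul r)]
    · apply setLIntegral_congr_fun measurableSet_Ioo
      intro t ht
      have ht0 : 0 < t := hr.trans ht.1
      simp only
      rw [← ENNReal.ofReal_mul (by positivity)]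
      congr 1
      field_simp
    · filter_upwards [hxnn] with t ht using mul_nonneg hr.le ht
  have e2 : ∫⁻ t in Ioo r 1, ENNReal.ofReal (r / t ^ 2) * ENNReal.ofReal (U t)
      = ENNReal.ofReal (r * ∫ t in Ioo r 1, U t / t ^ 2) := by
    rw [← integral_const_mul, ofReal_integral_eq_lintegral_ofReal (hUi.const_mul r)]
    · apply setLIntegral_congr_fun measurableSet_Ioo
      intro t ht
      simp only
      rw [← ENNReal.ofReal_mul (by positivity)]
      congr 1
      ring
    · filter_upwards [hUnn] with t ht using mul_nonneg hr.le ht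
  have n1 : 0 ≤ r * ∫ t in Ioo r 1, x t / t := mul_nonneg hr.le (integral_nonneg_of_ae hxnn)
  have n2 : 0 ≤ r * ∫ t in Ioo r 1, U t / t ^ 2 := mul_nonneg hr.le (integral_nonneg_of_ae hUnn)
  rw [RegretAuction.lintegral_isoMeasure r (by fun_prop),
    RegretAuction.lintegral_isoMeasure r (by fun_prop), e1, e2, one_mul,
    ← ENNReal.ofReal_mul hr.le, ← ENNReal.ofReal_mul hr.le]
  rw [← ENNReal.ofReal_add n1 (by positivity), ← ENNReal.ofReal_add (by positivity) hUr,
    ← ENNReal.ofReal_add n2 (by positivity), ← ENNReal.ofReal_add (by positivity) (by positivity),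
    heq]
  congr 1
  field_simp
  ring

end OneBuyer

/-! ### Product measures are exchangeable and affiliated -/

lemma ennreal_add_le_add_of_mul_le_mul {a b c d : ℝ≥0∞} (hac : a ≤ c) (hbc : b ≤ c)
    (h : a * b ≤ c * d) : a + b ≤ c + d := by
  rcases eq_or_ne c ∞ with rfl | hc
  · simp
  rcases eq_or_ne d ∞ with rfl | hd
  · simp
  lift c to NNReal using hc
  lift d to NNReal using hd
  lift a to NNReal using ne_top_of_le_ne_top ENNReal.coe_ne_top hac
  lift b to NNReal using ne_top_of_le_ne_top ENNReal.coe_ne_top hbc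
  norm_cast at *
  rcases eq_or_ne c 0 with rfl | hc0
  · rw [nonpos_iff_eq_zero] at hac hbc
    simp [hac, hbc]
  have hc0' : (0 : ℝ) < c := by exact_mod_cast pos_iff_ne_zero.2 hc0
  have h1 : (a : ℝ) ≤ c := hac
  have h2 : (b : ℝ) ≤ c := hbc
  have h3 : (a : ℝ) * b ≤ c * d := by exact_mod_cast h
  have : (a : ℝ) + b ≤ c + d := by
    refine le_of_mul_le_mul_left ?_ hc0'
    nlinarith [mul_nonneg (sub_nonneg.2 h1) (sub_nonneg.2 h2)]
  exact_mod_cast this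

/-- The four functions theorem on a linear order: it follows from a pointwise inequality for the
symmetrized integrands on the square. -/
lemma four_functions_lintegral {α : Type*} [LinearOrder α] [MeasurableSpace α] (μ : Measure α)
    [SFinite μ] {f₁ f₂ f₃ f₄ : α → ℝ≥0∞} (h₁ : Measurable f₁) (h₂ : Measurable f₂)
    (h₃ : Measurable f₃) (h₄ : Measurable f₄)
    (h : ∀ x y, f₁ x * f₂ y ≤ f₃ (x ⊔ y) * f₄ (x ⊓ y)) :
    (∫⁻ x, f₁ x ∂μ) * (∫⁻ x, f₂ x ∂μ) ≤ (∫⁻ x, f₃ x ∂μ) * (∫⁻ x, f₄ x ∂μ) := by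
  have key : ∀ x y, x ≤ y → f₁ x * f₂ y + f₂ x * f₁ y ≤ f₃ x * f₄ y + f₄ x * f₃ y := by
    intro x y hxy
    rw [add_comm (f₃ x * f₄ y)]
    apply ennreal_add_le_add_of_mul_le_mul
    · simpa [sup_eq_right.2 hxy, inf_eq_left.2 hxy, mul_comm] using h x y
    · simpa [sup_eq_left.2 hxy, inf_eq_right.2 hxy, mul_comm] using h y x
    · have e1 : f₁ x * f₂ x ≤ f₃ x * f₄ x := by simpa using h x x
      have e2 : f₁ y * f₂ y ≤ f₃ y * f₄ y := by simpa using h y y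
      calc f₁ x * f₂ y * (f₂ x * f₁ y) = (f₁ x * f₂ x) * (f₁ y * f₂ y) := by ring
        _ ≤ (f₃ x * f₄ x) * (f₃ y * f₄ y) := mul_le_mul' e1 e2
        _ = _ := by ring
  have sym : ∫⁻ z, (f₁ z.1 * f₂ z.2 + f₂ z.1 * f₁ z.2) ∂(μ.prod μ)
      ≤ ∫⁻ z, (f₃ z.1 * f₄ z.2 + f₄ z.1 * f₃ z.2) ∂(μ.prod μ) := by
    apply lintegral_mono
    rintro ⟨x, y⟩
    rcases le_total x y with hxy | hxy
    · exact key x y hxy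
    · have := key y x hxy
      simp only
      rw [mul_comm (f₁ x), mul_comm (f₂ x), mul_comm (f₃ x), mul_comm (f₄ x)]
      rwa [add_comm (f₁ y * f₂ x), add_comm (f₃ y * f₄ x)] at this
  have e : ∀ f g : α → ℝ≥0∞, Measurable f → Measurable g →
      ∫⁻ z, (f z.1 * g z.2 + g z.1 * f z.2) ∂(μ.prod μ)
        = 2 * ((∫⁻ x, f x ∂μ) * (∫⁻ x, g x ∂μ)) := by
    intro f g hf hg
    rw [lintegral_add_left (by fun_prop), lintegral_prod_mul hf.aemeasurable hg.aemeasurable,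
      lintegral_prod_mul hg.aemeasurable hf.aemeasurable, two_mul, mul_comm (∫⁻ x, g x ∂μ)]
  rw [e f₁ f₂ h₁ h₂, e f₃ f₄ h₃ h₄] at sym
  exact (ENNReal.mul_le_mul_iff_right two_ne_zero ENNReal.ofNat_ne_top).1 sym

lemma measurable_finCons (n : ℕ) :
    Measurable fun z : ℝ × (Fin n → ℝ) => (Fin.cons z.1 z.2 : Fin (n + 1) → ℝ) := by
  refine measurable_pi_iff.2 fun i => ?_
  refine Fin.cases ?_ (fun j => ?_) i
  · simpa using measurable_fst
  · simp only [Fin.cons_succ]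
    fun_prop

lemma lintegral_pi_succ {n : ℕ} (G : Measure ℝ) [IsProbabilityMeasure G]
    {f : (Fin (n + 1) → ℝ) → ℝ≥0∞} (hf : Measurable f) :
    ∫⁻ v, f v ∂(Measure.pi fun _ : Fin (n + 1) => G)
      = ∫⁻ t, ∫⁻ v, f (Fin.cons t v) ∂(Measure.pi fun _ : Fin n => G) ∂G := by
  have hmp := (measurePreserving_piFinSuccAbove (fun _ : Fin (n + 1) => G) 0).symm
  have he : ∀ z : ℝ × (Fin n → ℝ), (MeasurableEquiv.piFinSuccAbove (fun _ => ℝ) 0).symm z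
      = (Fin.cons z.1 z.2 : Fin (n + 1) → ℝ) := fun z => Fin.insertNth_zero' z.1 z.2
  rw [← hmp.lintegral_comp hf]
  simp only [he]
  exact lintegral_prod (μ := G) (ν := Measure.pi fun _ : Fin n => G)
    (fun z : ℝ × (Fin n → ℝ) => f (Fin.cons z.1 z.2))
    (hf.comp (measurable_finCons n)).aemeasurable

lemma measurable_lintegral_cons {n : ℕ} (G : Measure ℝ) [IsProbabilityMeasure G]
    {f : (Fin (n + 1) → ℝ) → ℝ≥0∞} (hf : Measurable f) :
    Measurable fun t : ℝ => ∫⁻ v, f (Fin.cons t v) ∂(Measure.pi fun _ : Fin n => G) := by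
  exact (hf.comp (measurable_finCons n)).lintegral_prod_right'

lemma four_functions_pi (G : Measure ℝ) [IsProbabilityMeasure G] (n : ℕ) :
    ∀ {f₁ f₂ f₃ f₄ : (Fin n → ℝ) → ℝ≥0∞}, Measurable f₁ → Measurable f₂ → Measurable f₃ →
      Measurable f₄ → (∀ x y, f₁ x * f₂ y ≤ f₃ (x ⊔ y) * f₄ (x ⊓ y)) →
      (∫⁻ x, f₁ x ∂(Measure.pi fun _ => G)) * (∫⁻ x, f₂ x ∂(Measure.pi fun _ => G))
        ≤ (∫⁻ x, f₃ x ∂(Measure.pi fun _ => G)) * (∫⁻ x, f₄ x ∂(Measure.pi fun _ => G)) := by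
  induction n with
  | zero =>
    intro f₁ f₂ f₃ f₄ h₁ h₂ h₃ h₄ h
    simp only [lintegral_unique, measure_univ, mul_one]
    convert h default default using 2 <;> exact congrArg _ (Subsingleton.elim _ _)
  | succ n ih =>
    intro f₁ f₂ f₃ f₄ h₁ h₂ h₃ h₄ h
    rw [lintegral_pi_succ G h₁, lintegral_pi_succ G h₂, lintegral_pi_succ G h₃,
      lintegral_pi_succ G h₄]
    have hc : ∀ t : ℝ, Measurable fun v : Fin n → ℝ => (Fin.cons t v : Fin (n + 1) → ℝ) :=
      fun t => (measurable_finCons n).comp measurable_prodMk_left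
    apply four_functions_lintegral G (measurable_lintegral_cons G h₁)
      (measurable_lintegral_cons G h₂) (measurable_lintegral_cons G h₃)
      (measurable_lintegral_cons G h₄)
    intro s t
    apply ih (h₁.comp (hc _)) (h₂.comp (hc _)) (h₃.comp (hc _)) (h₄.comp (hc _))
    intro x y
    have e1 : (Fin.cons (s ⊔ t) (x ⊔ y) : Fin (n + 1) → ℝ) = Fin.cons s x ⊔ Fin.cons t y := by
      funext i
      refine Fin.cases ?_ (fun j => ?_) i <;> simp
    have e2 : (Fin.cons (s ⊓ t) (x ⊓ y) : Fin (n + 1) → ℝ) = Fin.cons s x ⊓ Fin.cons t y := by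
      funext i
      refine Fin.cases ?_ (fun j => ?_) i <;> simp
    simp only [Function.comp_apply, e1, e2]
    exact h _ _

lemma affiliated_iff {n : ℕ} (F : Measure (Fin n → ℝ)) [IsFiniteMeasure F] :
    Affiliated F ↔ ∀ A B S : Set (Fin n → ℝ), MeasurableSet A → MeasurableSet B →
      MeasurableSet S → IsUpperSet A → IsUpperSet B → IsSublattice S →
        F (S ∩ A) * F (S ∩ B) ≤ F S * F (S ∩ (A ∩ B)) := by
  refine forall_congr' fun A => forall_congr' fun B => forall_congr' fun S =>
    forall_congr' fun _ => forall_congr' fun _ => forall_congr' fun hS =>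
    forall_congr' fun _ => forall_congr' fun _ => forall_congr' fun _ => ?_
  rcases eq_or_ne (F S) 0 with h0 | h0
  · simp only [h0, ne_eq, not_true_eq_false, false_imp_iff, true_iff, zero_mul, nonpos_iff_eq_zero,
      mul_eq_zero]
    exact Or.inl (measure_mono_null inter_subset_left h0)
  · simp only [h0, ne_eq, not_false_iff, true_imp_iff]
    have ht : F S ≠ ∞ := measure_ne_top F S
    rw [cond_apply hS, cond_apply hS, cond_apply hS]
    have e : F S * (F S * ((F S)⁻¹ * F (S ∩ A) * ((F S)⁻¹ * F (S ∩ B))))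
        = F (S ∩ A) * F (S ∩ B) := by
      calc _ = (F S * (F S)⁻¹) * (F S * (F S)⁻¹) * (F (S ∩ A) * F (S ∩ B)) := by ring
        _ = _ := by rw [ENNReal.mul_inv_cancel h0 ht, one_mul, one_mul]
    have e' : F S * (F S * ((F S)⁻¹ * F (S ∩ (A ∩ B)))) = F S * F (S ∩ (A ∩ B)) := by
      rw [← mul_assoc (F S) (F S)⁻¹, ENNReal.mul_inv_cancel h0 ht, one_mul]
    rw [← e, ← e', ENNReal.mul_le_mul_iff_right h0 ht, ENNReal.mul_le_mul_iff_right h0 ht]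

lemma affiliated_pi (n : ℕ) (G : Measure ℝ) [IsProbabilityMeasure G] :
    Affiliated (Measure.pi fun _ : Fin n => G) := by
  rw [affiliated_iff]
  intro A B S hA hB hS hAu hBu hSl
  have h := four_functions_pi G n (f₁ := (S ∩ A).indicator 1) (f₂ := (S ∩ B).indicator 1)
    (f₃ := (S ∩ (A ∩ B)).indicator 1) (f₄ := S.indicator 1)
    (measurable_one.indicator (hS.inter hA)) (measurable_one.indicator (hS.inter hB))
    (measurable_one.indicator (hS.inter (hA.inter hB))) (measurable_one.indicator hS) ?_
  · rw [lintegral_indicator_one (hS.inter hA), lintegral_indicator_one (hS.inter hB),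
      lintegral_indicator_one (hS.inter (hA.inter hB)), lintegral_indicator_one hS] at h
    rwa [mul_comm (Measure.pi _ S)]
  · intro x y
    by_cases hx : x ∈ S ∩ A
    · by_cases hy : y ∈ S ∩ B
      · have h1 : x ⊔ y ∈ S ∩ (A ∩ B) := ⟨hSl.supClosed hx.1 hy.1,
          hAu le_sup_left hx.2, hBu le_sup_right hy.2⟩
        have h2 : x ⊓ y ∈ S := hSl.infClosed hx.1 hy.1
        simp [indicator_of_mem hx, indicator_of_mem hy, indicator_of_mem h1, indicator_of_mem h2]
      · simp [indicator_of_notMem hy]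
    · simp [indicator_of_notMem hx]

lemma exchangeable_pi (n : ℕ) (G : Measure ℝ) [IsProbabilityMeasure G] :
    Exchangeable (Measure.pi fun _ : Fin n => G) := by
  intro σ
  symm
  apply Measure.pi_eq
  intro s hs
  rw [Measure.map_apply (by fun_prop) (MeasurableSet.univ_pi hs)]
  have : (fun v : Fin n → ℝ => v ∘ σ) ⁻¹' univ.pi s = univ.pi fun i => s (σ.symm i) := by
    ext v
    simp only [mem_preimage, mem_univ_pi, Function.comp_apply]
    exact ⟨fun h i => by simpa using h (σ.symm i), fun h i => by simpa using h (σ i)⟩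
  rw [this, Measure.pi_pi]
  exact Equiv.prod_comp σ.symm fun i => G (s i)

lemma iidClass_subset_affClass (n : ℕ) : iidClass n ⊆ affClass n := by
  rintro F ⟨G, hG, hG1, rfl⟩
  refine ⟨inferInstance, ?_, exchangeable_pi n G, affiliated_pi n G⟩
  rw [Valuations, ← Set.pi_univ_Icc, Measure.pi_pi]
  simp [hG1]

/-! ### The two highest bids -/

section OrderStatistics

variable {m : ℕ} (v : Fin (m + 1) → ℝ)

lemma maxVal_le_iff {t : ℝ} : maxVal v ≤ t ↔ ∀ i, v i ≤ t :=
  ciSup_le_iff (Set.finite_range v).bddAbove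

lemma le_maxVal (i : Fin (m + 1)) : v i ≤ maxVal v := (maxVal_le_iff v).1 le_rfl i

lemma exists_eq_maxVal : ∃ i, v i = maxVal v := exists_eq_ciSup_of_finite

lemma measurable_maxVal : Measurable (maxVal : (Fin (m + 1) → ℝ) → ℝ) := by
  refine measurable_of_Iic fun t => ?_
  have : maxVal ⁻¹' Iic t = ⋂ i, {v : Fin (m + 1) → ℝ | v i ≤ t} := by
    ext v
    simp [maxVal_le_iff]
  rw [this]
  exact MeasurableSet.iInter fun i => measurableSet_le (measurable_pi_apply i) measurable_const

lemma maxVal_nonneg {v : Fin (m + 1) → ℝ} (hv : v ∈ Valuations (m + 1)) : 0 ≤ maxVal v :=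
  (hv.1 0).trans (le_maxVal v 0)

lemma maxVal_le_one {v : Fin (m + 1) → ℝ} (hv : v ∈ Valuations (m + 1)) : maxVal v ≤ 1 :=
  (maxVal_le_iff v).2 fun i => hv.2 i

/-- The highest bid of the competitors of buyer `i`; it is `0` if there are none. -/
noncomputable def otherMax (i : Fin (m + 1)) : ℝ := ⨆ j : {j // j ≠ i}, v j

lemma otherMax_le_iff (hm : 0 < m) {i : Fin (m + 1)} {t : ℝ} :
    otherMax v i ≤ t ↔ ∀ j, j ≠ i → v j ≤ t := by
  have : Nontrivial (Fin (m + 1)) := Fin.nontrivial_iff_two_le.2 (by omega)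
  obtain ⟨j, hj⟩ := exists_ne i
  have : Nonempty {j // j ≠ i} := ⟨⟨j, hj⟩⟩
  rw [otherMax, ciSup_le_iff (Set.finite_range _).bddAbove]
  simp

lemma otherMax_update (i : Fin (m + 1)) (w : ℝ) :
    otherMax (Function.update v i w) i = otherMax v i := by
  unfold otherMax
  congr 1
  funext j
  simp [j.2]

lemma secondVal_le_iff (hm : 0 < m) {t : ℝ} :
    secondVal v ≤ t ↔ ∃ i, ∀ j, j ≠ i → v j ≤ t := by
  have h : 1 < m + 1 := by omega
  have hmono := Tuple.monotone_sort v
  rw [secondVal, dif_pos h]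
  constructor
  · intro hle
    refine ⟨Tuple.sort v (Fin.last m), fun j hj => ?_⟩
    obtain ⟨k, rfl⟩ := (Tuple.sort v).surjective j
    have hk : k ≠ Fin.last m := fun hk => hj (by rw [hk])
    refine le_trans (hmono (?_ : k ≤ ⟨m + 1 - 2, by omega⟩)) hle
    have : k.1 ≠ m := fun hk' => hk (Fin.ext hk')
    rw [Fin.le_def]
    simp only
    omega
  · rintro ⟨i, hi⟩
    by_cases h1 : Tuple.sort v ⟨m + 1 - 2, by omega⟩ = i
    · refine le_trans (hmono (Fin.le_last _)) (hi (Tuple.sort v (Fin.last m)) ?_)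
      rw [← h1]
      intro hcon
      have := (Tuple.sort v).injective hcon
      rw [Fin.ext_iff] at this
      simp only [Fin.val_last] at this
      omega
    · exact hi _ h1

variable {v} in
lemma secondVal_eq_otherMax {i : Fin (m + 1)} (hi : v i = maxVal v) :
    secondVal v = otherMax v i := by
  rcases Nat.eq_zero_or_pos m with rfl | hm
  · have : IsEmpty {j : Fin (0 + 1) // j ≠ i} := ⟨fun j => j.2 (Subsingleton.elim (α := Fin 1) _ _)⟩
    simp [secondVal, otherMax, Real.iSup_of_isEmpty]
  · apply eq_of_forall_ge_iff
    intro t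
    rw [secondVal_le_iff v hm, otherMax_le_iff v hm]
    refine ⟨?_, fun h => ⟨i, h⟩⟩
    rintro ⟨k, hk⟩ j hj
    by_cases hjk : j = k
    · have h1 := hk i (by rintro rfl; exact hj hjk)
      rw [hi] at h1
      exact (le_maxVal v j).trans h1
    · exact hk j hjk

lemma measurable_secondVal : Measurable (secondVal : (Fin (m + 1) → ℝ) → ℝ) := by
  rcases Nat.eq_zero_or_pos m with rfl | hm
  · have : (secondVal : (Fin (0 + 1) → ℝ) → ℝ) = fun _ => 0 := by
      funext v
      simp [secondVal]
    rw [this]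
    exact measurable_const
  · refine measurable_of_Iic fun t => ?_
    have : secondVal ⁻¹' Iic t
        = ⋃ i, ⋂ j, ⋂ (_ : j ≠ i), {v : Fin (m + 1) → ℝ | v j ≤ t} := by
      ext v
      simp [secondVal_le_iff v hm]
    rw [this]
    exact MeasurableSet.iUnion fun i => MeasurableSet.iInter fun j => MeasurableSet.iInter fun _ =>
      measurableSet_le (measurable_pi_apply j) measurable_const

variable {v}

lemma secondVal_le_maxVal (hv : v ∈ Valuations (m + 1)) : secondVal v ≤ maxVal v := by
  rcases Nat.eq_zero_or_pos m with rfl | hm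
  · simpa [secondVal] using maxVal_nonneg hv
  · exact (secondVal_le_iff v hm).2 ⟨0, fun j _ => le_maxVal v j⟩

lemma secondVal_nonneg (hv : v ∈ Valuations (m + 1)) : 0 ≤ secondVal v := by
  unfold secondVal
  split_ifs with h
  · exact hv.1 _
  · exact le_rfl

lemma update_mem_valuations (hv : v ∈ Valuations (m + 1)) (i : Fin (m + 1)) {w : ℝ}
    (hw : w ∈ Icc (0 : ℝ) 1) : Function.update v i w ∈ Valuations (m + 1) := by
  constructor
  · intro j
    rcases eq_or_ne j i with rfl | hj
    · simpa using hw.1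
    · simpa [hj] using hv.1 j
  · intro j
    rcases eq_or_ne j i with rfl | hj
    · simpa using hw.2
    · simpa [hj] using hv.2 j

end OrderStatistics

/-! ### The second-price auction with random reserve is DSIC -/

lemma IsTieBreaking.le_one {n : ℕ} {τ : (Fin n → ℝ) → Fin n → ℝ} (hτ : IsTieBreaking τ)
    (v : Fin n → ℝ) (i : Fin n) : τ v i ≤ 1 := by
  rw [← hτ.sum_eq_one v]
  exact Finset.single_le_sum (fun j _ => hτ.nonneg v j) (Finset.mem_univ i)

section SPA

variable {m : ℕ} {τ : (Fin (m + 1) → ℝ) → Fin (m + 1) → ℝ} (Ψ : Measure ℝ)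
  [IsProbabilityMeasure Ψ]

lemma integrableOn_max (s M : ℝ) : IntegrableOn (fun p => max s p) (Iic M) Ψ := by
  apply Measure.integrableOn_of_bounded (M := |s| + |M|) (measure_ne_top Ψ _)
    (by fun_prop : Measurable fun p : ℝ => max s p).aestronglyMeasurable
  filter_upwards [ae_restrict_mem measurableSet_Iic] with p hp
  have hp' : p ≤ M := hp
  rw [Real.norm_eq_abs, abs_le]
  constructor
  · linarith [neg_abs_le s, abs_nonneg M, le_max_left s p]
  · exact max_le (by linarith [le_abs_self s, abs_nonneg M])
      (by linarith [le_abs_self M, abs_nonneg s])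

/-- The utility from the bid vector `w` of a buyer `i` with valuation `y`. -/
lemma spa_utility (w : Fin (m + 1) → ℝ) (i : Fin (m + 1)) (y : ℝ) :
    y * (spa τ Ψ).alloc w i - (spa τ Ψ).pay w i
      = τ w i * ∫ p in Iic (maxVal w), (y - max (secondVal w) p) ∂Ψ := by
  rw [integral_sub (integrable_const _) (integrableOn_max Ψ _ _), setIntegral_const]
  simp only [spa, smul_eq_mul]
  ring

lemma integrable_pos_part_sub_max (c y : ℝ) : Integrable (fun p => max (y - max c p) 0) Ψ := by
  apply Integrable.of_bound (C := |y - c|)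
    (by fun_prop : Measurable fun p : ℝ => max (y - max c p) 0).aestronglyMeasurable
  refine Eventually.of_forall fun p => ?_
  rw [Real.norm_of_nonneg (le_max_right _ _)]
  exact max_le (by linarith [le_max_left c p, le_abs_self (y - c)]) (abs_nonneg _)

/-- No bid of buyer `i` yields more than the expected positive part of `y - max (c, p)`, where `c`
is the highest bid of the competitors. -/
lemma spa_utility_le (hτ : IsTieBreaking τ) (w : Fin (m + 1) → ℝ) (i : Fin (m + 1)) (y : ℝ) :
    y * (spa τ Ψ).alloc w i - (spa τ Ψ).pay w i
      ≤ ∫ p, max (y - max (otherMax w i) p) 0 ∂Ψ := by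
  have hint := integrable_pos_part_sub_max Ψ (otherMax w i) y
  have hnn : 0 ≤ ∫ p, max (y - max (otherMax w i) p) 0 ∂Ψ :=
    integral_nonneg fun p => le_max_right _ _
  rw [spa_utility]
  by_cases hi : w i = maxVal w
  · rw [secondVal_eq_otherMax hi]
    have h1 : ∫ p in Iic (maxVal w), (y - max (otherMax w i) p) ∂Ψ
        ≤ ∫ p, max (y - max (otherMax w i) p) 0 ∂Ψ := by
      calc _ ≤ ∫ p in Iic (maxVal w), max (y - max (otherMax w i) p) 0 ∂Ψ :=
            integral_mono ((integrable_const y).sub (integrableOn_max Ψ _ _)) hint.integrableOn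
              fun p => le_max_left _ _
        _ ≤ _ := setIntegral_le_integral hint (Eventually.of_forall fun p => le_max_right _ _)
    calc _ ≤ τ w i * ∫ p, max (y - max (otherMax w i) p) 0 ∂Ψ :=
          mul_le_mul_of_nonneg_left h1 (hτ.nonneg w i)
      _ ≤ _ := mul_le_of_le_one_left hnn (hτ.le_one w i)
  · rw [hτ.highest w i hi, zero_mul]
    exact hnn

lemma spa_utility_nonneg (hτ : IsTieBreaking τ) {v : Fin (m + 1) → ℝ}
    (hv : v ∈ Valuations (m + 1)) (i : Fin (m + 1)) :
    0 ≤ v i * (spa τ Ψ).alloc v i - (spa τ Ψ).pay v i := by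
  rw [spa_utility]
  by_cases hi : v i = maxVal v
  · refine mul_nonneg (hτ.nonneg v i) (setIntegral_nonneg measurableSet_Iic fun p hp => ?_)
    rw [hi, sub_nonneg]
    exact max_le (secondVal_le_maxVal hv) hp
  · rw [hτ.highest v i hi, zero_mul]

/-- Bidding truthfully attains the bound of `spa_utility_le`. -/
lemma le_spa_utility (hτ : IsTieBreaking τ) {v : Fin (m + 1) → ℝ}
    (hv : v ∈ Valuations (m + 1)) (i : Fin (m + 1)) :
    ∫ p, max (v i - max (otherMax v i) p) 0 ∂Ψ
      ≤ v i * (spa τ Ψ).alloc v i - (spa τ Ψ).pay v i := by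
  rcases le_or_gt (v i) (otherMax v i) with hle | hlt
  · refine le_trans (le_of_eq ?_) (spa_utility_nonneg Ψ hτ hv i)
    refine integral_eq_zero_of_ae (Eventually.of_forall fun p => ?_)
    exact max_eq_right (sub_nonpos.2 (hle.trans (le_max_left (otherMax v i) p)))
  · have hother : ∀ j, j ≠ i → v j < v i := by
      intro j hj
      have hm : 0 < m := by
        by_contra hm
        obtain rfl : m = 0 := by omega
        exact hj (Subsingleton.elim (α := Fin 1) _ _)
      exact ((otherMax_le_iff v hm).1 le_rfl j hj).trans_lt hlt
    have hi : v i = maxVal v := by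
      refine le_antisymm (le_maxVal v i) ((maxVal_le_iff v).2 fun j => ?_)
      rcases eq_or_ne j i with rfl | hj
      · exact le_rfl
      · exact (hother j hj).le
    have hτ1 : τ v i = 1 := by
      rw [← hτ.sum_eq_one v]
      refine (Finset.sum_eq_single i (fun j _ hj => hτ.highest v j ?_) (by simp)).symm
      rw [← hi]
      exact (hother j hj).ne
    rw [spa_utility, hτ1, one_mul, secondVal_eq_otherMax hi, ← hi,
      ← setIntegral_eq_integral_of_forall_compl_eq_zero (s := Iic (v i))]
    · refine le_of_eq (setIntegral_congr_fun measurableSet_Iic fun p hp => ?_)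
      exact max_eq_left (sub_nonneg.2 (max_le hlt.le hp))
    · intro p hp
      have hp' : v i < p := by simpa using hp
      exact max_eq_right (by linarith [le_max_right (otherMax v i) p])

lemma measurable_cdf_maxVal : Measurable fun v : Fin (m + 1) → ℝ => Ψ.real (Iic (maxVal v)) := by
  have : Monotone fun t : ℝ => Ψ.real (Iic t) := fun s t hst =>
    measureReal_mono (Iic_subset_Iic.2 hst)
  exact this.measurable.comp measurable_maxVal

lemma measurable_spa_revenue : Measurable fun v : Fin (m + 1) → ℝ =>
    ∫ p in Iic (maxVal v), max (secondVal v) p ∂Ψ := by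
  have hms : MeasurableSet {z : (Fin (m + 1) → ℝ) × ℝ | z.2 ≤ maxVal z.1} :=
    measurableSet_le measurable_snd (measurable_maxVal.comp measurable_fst)
  have hm : Measurable ({z : (Fin (m + 1) → ℝ) × ℝ | z.2 ≤ maxVal z.1}.indicator
      fun z => max (secondVal z.1) z.2) :=
    ((measurable_secondVal.comp measurable_fst).max measurable_snd).indicator hms
  have := (hm.stronglyMeasurable.integral_prod_right' (ν := Ψ)).measurable
  convert this using 2 with v
  rw [← integral_indicator measurableSet_Iic]
  rfl

lemma spa_mem_dsicMechanisms (hτ : IsTieBreaking τ) : spa τ Ψ ∈ dsicMechanisms (m + 1) where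
  measurable_alloc := measurable_pi_iff.2 fun i =>
    ((measurable_pi_apply i).comp hτ.measurable).mul (measurable_cdf_maxVal Ψ)
  measurable_pay := measurable_pi_iff.2 fun i =>
    ((measurable_pi_apply i).comp hτ.measurable).mul (measurable_spa_revenue Ψ)
  alloc_mem v _ i := ⟨mul_nonneg (hτ.nonneg v i) measureReal_nonneg,
    mul_le_one₀ (hτ.le_one v i) measureReal_nonneg measureReal_le_one⟩
  ir v hv i := spa_utility_nonneg Ψ hτ hv i
  ic v hv i w _ := by
    refine (spa_utility_le Ψ hτ (Function.update v i w) i (v i)).trans ?_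
    rw [otherMax_update]
    exact le_spa_utility Ψ hτ hv i
  ac v _ := by
    simp only [spa]
    rw [← Finset.sum_mul, hτ.sum_eq_one, one_mul]
    exact measureReal_le_one

end SPA

/-- Ties are broken uniformly at random. -/
noncomputable def uniformTieBreaking {n : ℕ} (v : Fin n → ℝ) (i : Fin n) : ℝ :=
  {w : Fin n → ℝ | w i = maxVal w}.indicator 1 v
    / ∑ j, {w : Fin n → ℝ | w j = maxVal w}.indicator 1 v

lemma isTieBreaking_uniformTieBreaking (m : ℕ) :
    IsTieBreaking (uniformTieBreaking : (Fin (m + 1) → ℝ) → Fin (m + 1) → ℝ) where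
  measurable := by
    have h : ∀ i, Measurable ({w : Fin (m + 1) → ℝ | w i = maxVal w}.indicator
        (1 : (Fin (m + 1) → ℝ) → ℝ)) :=
      fun i => measurable_one.indicator (measurableSet_eq_fun (measurable_pi_apply i)
        measurable_maxVal)
    exact measurable_pi_iff.2 fun i => (h i).div (Finset.measurable_fun_sum _ fun j _ => h j)
  nonneg v i := div_nonneg (indicator_nonneg (by simp) v)
    (Finset.sum_nonneg fun j _ => indicator_nonneg (by simp) v)
  sum_eq_one v := by
    unfold uniformTieBreaking
    rw [← Finset.sum_div]
    apply div_self
    obtain ⟨i, hi⟩ := exists_eq_maxVal v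
    apply ne_of_gt
    refine lt_of_lt_of_le ?_ (Finset.single_le_sum (fun j _ => indicator_nonneg (by simp) v)
      (Finset.mem_univ i))
    rw [indicator_of_mem (show v ∈ {w : Fin (m + 1) → ℝ | w i = maxVal w} from hi)]
    simp
  highest v i hi := by
    unfold uniformTieBreaking
    rw [indicator_of_notMem (show v ∉ {w : Fin _ → ℝ | w i = maxVal w} from hi), zero_div]

/-! ### No mechanism beats the auction against the isorevenue distribution -/

lemma measurable_update_prod {n : ℕ} (i : Fin n) :
    Measurable fun z : (Fin n → ℝ) × ℝ => Function.update z.1 i z.2 := by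
  refine measurable_pi_iff.2 fun j => ?_
  rcases eq_or_ne j i with rfl | hj
  · simpa using measurable_snd
  · simp only [Function.update_of_ne hj]
    fun_prop

lemma measurable_update_right {n : ℕ} (v : Fin n → ℝ) (i : Fin n) :
    Measurable fun t : ℝ => Function.update v i t :=
  (measurable_update_prod i).comp measurable_prodMk_left

lemma measurable_update_left {n : ℕ} (i : Fin n) (t : ℝ) :
    Measurable fun v : Fin n → ℝ => Function.update v i t :=
  (measurable_update_prod i).comp measurable_prodMk_right

/-- Resampling one coordinate leaves a product measure invariant. -/
lemma measurePreserving_update {n : ℕ} (G : Measure ℝ) [IsProbabilityMeasure G] (i : Fin n) :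
    MeasurePreserving (fun z : (Fin n → ℝ) × ℝ => Function.update z.1 i z.2)
      ((Measure.pi fun _ => G).prod G) (Measure.pi fun _ => G) := by
  refine ⟨measurable_update_prod i, (Measure.pi_eq fun s hs => ?_).symm⟩
  rw [Measure.map_apply (measurable_update_prod i) (MeasurableSet.univ_pi hs)]
  have : (fun z : (Fin n → ℝ) × ℝ => Function.update z.1 i z.2) ⁻¹' univ.pi s
      = (univ.pi (Function.update s i univ)) ×ˢ s i := by
    ext ⟨v, t⟩
    simp only [mem_preimage, mem_univ_pi, mem_prod]
    constructor
    · intro h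
      refine ⟨fun j => ?_, by simpa using h i⟩
      rcases eq_or_ne j i with rfl | hj
      · simp
      · simpa [hj] using h j
    · rintro ⟨h1, h2⟩ j
      rcases eq_or_ne j i with rfl | hj
      · simpa using h2
      · simpa [hj] using h1 j
  rw [this, Measure.prod_prod, Measure.pi_pi,
    ← Finset.prod_erase_mul Finset.univ (fun j => G (s j)) (Finset.mem_univ i),
    ← Finset.prod_erase_mul Finset.univ _ (Finset.mem_univ i)]
  simp only [Function.update_self, measure_univ, mul_one]
  congr 1
  refine Finset.prod_congr rfl fun j hj => ?_
  rw [Function.update_of_ne (Finset.ne_of_mem_erase hj)]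

lemma lintegral_pi_update {n : ℕ} (G : Measure ℝ) [IsProbabilityMeasure G] (i : Fin n)
    {f : (Fin n → ℝ) → ℝ≥0∞} (hf : Measurable f) :
    ∫⁻ v, f v ∂(Measure.pi fun _ => G)
      = ∫⁻ v, ∫⁻ t, f (Function.update v i t) ∂G ∂(Measure.pi fun _ => G) := by
  rw [← (measurePreserving_update G i).lintegral_comp hf]
  exact lintegral_prod (fun z : (Fin n → ℝ) × ℝ => f (Function.update z.1 i z.2))
    (hf.comp (measurable_update_prod i)).aemeasurable

section Mechanism

variable {m : ℕ} {M : Mechanism (m + 1)}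

/-- The utility of a truthful buyer. -/
def Mechanism.utility {n : ℕ} (M : Mechanism n) (v : Fin n → ℝ) (i : Fin n) : ℝ :=
  v i * M.alloc v i - M.pay v i

lemma Mechanism.IsDSIC.measurable_alloc_apply (hM : M.IsDSIC) (i : Fin (m + 1)) :
    Measurable fun v => M.alloc v i :=
  (measurable_pi_apply i).comp hM.measurable_alloc

lemma Mechanism.IsDSIC.measurable_utility (hM : M.IsDSIC) (i : Fin (m + 1)) :
    Measurable fun v => M.utility v i :=
  ((measurable_pi_apply i).mul (hM.measurable_alloc_apply i)).sub
    ((measurable_pi_apply i).comp hM.measurable_pay)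

lemma Mechanism.IsDSIC.isSubgradient (hM : M.IsDSIC) {v : Fin (m + 1) → ℝ}
    (hv : v ∈ Valuations (m + 1)) (i : Fin (m + 1)) :
    IsSubgradient (fun t => M.alloc (Function.update v i t) i)
      (fun t => M.utility (Function.update v i t) i) := by
  intro s hs t ht
  have := hM.ic _ (update_mem_valuations hv i hs) i t ht
  simp only [Mechanism.utility, Function.update_idem, Function.update_self] at this ⊢
  linarith

lemma Mechanism.IsDSIC.sum_mul_alloc_le (hM : M.IsDSIC) {v : Fin (m + 1) → ℝ}
    (hv : v ∈ Valuations (m + 1)) : ∑ i, v i * M.alloc v i ≤ maxVal v := by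
  calc ∑ i, v i * M.alloc v i ≤ ∑ i, maxVal v * M.alloc v i :=
        Finset.sum_le_sum fun i _ =>
          mul_le_mul_of_nonneg_right (le_maxVal v i) (hM.alloc_mem v hv i).1
    _ = maxVal v * ∑ i, M.alloc v i := (Finset.mul_sum _ _ _).symm
    _ ≤ maxVal v := mul_le_of_le_one_right (maxVal_nonneg hv) (hM.ac v hv)

variable {F : Measure (Fin (m + 1) → ℝ)}

/-- The regret is the welfare loss plus the utilities of the buyers. -/
lemma Mechanism.IsDSIC.regret_eq (hM : M.IsDSIC) (hF : ∀ᵐ v ∂F, v ∈ Valuations (m + 1)) :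
    regret M F = ∫⁻ v, ENNReal.ofReal (maxVal v - ∑ i, v i * M.alloc v i) ∂F
      + ∑ i, ∫⁻ v, ENNReal.ofReal (M.utility v i) ∂F := by
  have hm : ∀ i, Measurable fun v => ENNReal.ofReal (M.utility v i) := fun i =>
    (hM.measurable_utility i).ennreal_ofReal
  rw [← lintegral_finsetSum _ fun i _ => hm i,
    ← lintegral_add_right _ (Finset.measurable_fun_sum _ fun i _ => hm i), regret]
  refine lintegral_congr_ae (hF.mono fun v hv => ?_)
  simp only
  have hU : ∀ i ∈ Finset.univ, 0 ≤ M.utility v i := fun i _ => hM.ir v hv i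
  rw [← ENNReal.ofReal_sum_of_nonneg hU, ← ENNReal.ofReal_add
    (sub_nonneg.2 (hM.sum_mul_alloc_le hv)) (Finset.sum_nonneg hU)]
  congr 1
  simp only [Mechanism.utility, Finset.sum_sub_distrib]
  ring

lemma Mechanism.IsDSIC.lintegral_maxVal_eq (hM : M.IsDSIC)
    (hF : ∀ᵐ v ∂F, v ∈ Valuations (m + 1)) :
    ∫⁻ v, ENNReal.ofReal (maxVal v) ∂F
      = ∫⁻ v, ENNReal.ofReal (maxVal v - ∑ i, v i * M.alloc v i) ∂F
        + ∑ i, ∫⁻ v, ENNReal.ofReal (v i * M.alloc v i) ∂F := by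
  have hm : ∀ i, Measurable fun v : Fin (m + 1) → ℝ => ENNReal.ofReal (v i * M.alloc v i) :=
    fun i => ((measurable_pi_apply i).mul (hM.measurable_alloc_apply i)).ennreal_ofReal
  rw [← lintegral_finsetSum _ fun i _ => hm i,
    ← lintegral_add_right _ (Finset.measurable_fun_sum _ fun i _ => hm i)]
  refine lintegral_congr_ae (hF.mono fun v hv => ?_)
  simp only
  have hU : ∀ i ∈ Finset.univ, 0 ≤ v i * M.alloc v i := fun i _ =>
    mul_nonneg (hv.1 i) (hM.alloc_mem v hv i).1
  rw [← ENNReal.ofReal_sum_of_nonneg hU, ← ENNReal.ofReal_add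
    (sub_nonneg.2 (hM.sum_mul_alloc_le hv)) (Finset.sum_nonneg hU)]
  congr 1
  ring

lemma ae_mem_valuations_of_mem_affClass (hF : F ∈ affClass (m + 1)) :
    ∀ᵐ v ∂F, v ∈ Valuations (m + 1) := by
  have := hF.1
  exact (mem_ae_iff_prob_eq_one measurableSet_Icc).2 hF.2.1

variable {r : ℝ}

lemma pi_isoMeasure_mem_iidClass (n : ℕ) (hr : 0 < r) (hr1 : r < 1) :
    Measure.pi (fun _ : Fin n => isoMeasure r) ∈ iidClass n := by
  have := isProbabilityMeasure_isoMeasure hr hr1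
  refine ⟨isoMeasure r, this, le_antisymm prob_le_one ?_, rfl⟩
  rw [← isoMeasure_Icc hr hr1]
  exact measure_mono (Icc_subset_Icc_left hr.le)

lemma lintegral_isoMeasure_indicator_one (r : ℝ) {f : ℝ → ℝ≥0∞} (hf : Measurable f) :
    ∫⁻ t, ({1} : Set ℝ).indicator f t ∂(isoMeasure r) = ENNReal.ofReal r * f 1 := by
  rw [lintegral_isoMeasure r (hf.indicator (measurableSet_singleton 1))]
  have : ∫⁻ t in Ioo r 1, ENNReal.ofReal (r / t ^ 2) * ({1} : Set ℝ).indicator f t = 0 := by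
    rw [setLIntegral_congr_fun (g := fun _ => 0) measurableSet_Ioo]
    · simp
    · intro t ht
      simp only
      rw [indicator_of_notMem (by simpa using ht.2.ne), mul_zero]
  rw [this, zero_add, indicator_of_mem (mem_singleton _)]

/-- Against i.i.d. isorevenue valuations, the expected payment of buyer `i` is the probability that
`i` wins with a valuation of `1`, minus the expected utility that `i` would have with the
valuation `r`. -/
lemma Mechanism.IsDSIC.lintegral_pi_isoMeasure (hM : M.IsDSIC) (hr : 0 < r) (hr1 : r < 1)
    (i : Fin (m + 1)) :
    ∫⁻ v, ENNReal.ofReal (v i * M.alloc v i) ∂(Measure.pi fun _ => isoMeasure r)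
      + ∫⁻ v, ENNReal.ofReal (M.utility (Function.update v i r) i)
          ∂(Measure.pi fun _ => isoMeasure r)
      = ∫⁻ v, ENNReal.ofReal (M.utility v i) ∂(Measure.pi fun _ => isoMeasure r)
        + ∫⁻ v, {v : Fin (m + 1) → ℝ | v i = 1}.indicator (fun v => ENNReal.ofReal (M.alloc v i)) v
          ∂(Measure.pi fun _ => isoMeasure r) := by
  have := isProbabilityMeasure_isoMeasure hr hr1
  have hae := ae_mem_valuations_of_mem_affClass
    (iidClass_subset_affClass _ (pi_isoMeasure_mem_iidClass (m + 1) hr hr1))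
  have hx := hM.measurable_alloc_apply i
  have hU := hM.measurable_utility i
  have hms : MeasurableSet {v : Fin (m + 1) → ℝ | v i = 1} :=
    measurableSet_eq_fun (measurable_pi_apply i) measurable_const
  have hxm : Measurable fun v : Fin (m + 1) → ℝ => ENNReal.ofReal (v i * M.alloc v i) :=
    ((measurable_pi_apply i).mul hx).ennreal_ofReal
  rw [lintegral_pi_update _ i hxm, lintegral_pi_update _ i hU.ennreal_ofReal,
    lintegral_pi_update _ i (hx.ennreal_ofReal.indicator hms)]
  have hright : Measurable fun v : Fin (m + 1) → ℝ =>
      ∫⁻ t, {v : Fin (m + 1) → ℝ | v i = 1}.indicator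
        (fun v => ENNReal.ofReal (M.alloc v i)) (Function.update v i t) ∂(isoMeasure r) :=
    ((hx.ennreal_ofReal.indicator hms).comp (measurable_update_prod i)).lintegral_prod_right'
  have hleft : Measurable fun v : Fin (m + 1) → ℝ =>
      ENNReal.ofReal (M.utility (Function.update v i r) i) :=
    (hU.comp (measurable_update_left i r)).ennreal_ofReal
  rw [← lintegral_add_right _ hright, ← lintegral_add_right _ hleft]
  refine lintegral_congr_ae (hae.mono fun v hv => ?_)
  have hv' : ∀ t ∈ Icc (0 : ℝ) 1, Function.update v i t ∈ Valuations (m + 1) := fun t ht =>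
    update_mem_valuations hv i ht
  have key := (hM.isSubgradient hv i).lintegral_isoMeasure (hx.comp (measurable_update_right v i))
    (hU.comp (measurable_update_right v i)) (fun t ht => hM.alloc_mem _ (hv' t ht) i)
    (fun t ht => hM.ir _ (hv' t ht) i) hr hr1
  have hind := lintegral_isoMeasure_indicator_one r
    (hx.comp (measurable_update_right v i)).ennreal_ofReal
  rw [ENNReal.ofReal_mul hr.le] at key
  simp only [Function.update_self, Function.comp_apply] at hind ⊢
  rw [key, ← hind]
  congr 1
  refine lintegral_congr fun t => ?_
  by_cases ht : t = 1
  · rw [indicator_of_mem (by simpa using ht), indicator_of_mem (by simpa using ht)]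
  · rw [indicator_of_notMem (by simpa using ht), indicator_of_notMem (by simpa using ht)]

/-- The balance of welfare and revenue against i.i.d. isorevenue valuations. -/
lemma Mechanism.IsDSIC.regret_add_eq (hM : M.IsDSIC) (hr : 0 < r) (hr1 : r < 1) :
    ∫⁻ v, ENNReal.ofReal (maxVal v) ∂(Measure.pi fun _ : Fin (m + 1) => isoMeasure r)
      + ∑ i, ∫⁻ v, ENNReal.ofReal (M.utility (Function.update v i r) i)
          ∂(Measure.pi fun _ => isoMeasure r)
      = regret M (Measure.pi fun _ => isoMeasure r)
        + ∑ i, ∫⁻ v, {v : Fin (m + 1) → ℝ | v i = 1}.indicator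
          (fun v => ENNReal.ofReal (M.alloc v i)) v ∂(Measure.pi fun _ => isoMeasure r) := by
  have hae := ae_mem_valuations_of_mem_affClass
    (iidClass_subset_affClass _ (pi_isoMeasure_mem_iidClass (m + 1) hr hr1))
  rw [hM.lintegral_maxVal_eq hae, hM.regret_eq hae, add_assoc, add_assoc,
    ← Finset.sum_add_distrib, ← Finset.sum_add_distrib]
  congr 1
  exact Finset.sum_congr rfl fun i _ => hM.lintegral_pi_isoMeasure hr hr1 i

lemma measurableSet_maxVal_eq_one : MeasurableSet {v : Fin (m + 1) → ℝ | maxVal v = 1} :=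
  measurableSet_eq_fun measurable_maxVal measurable_const

lemma Mechanism.IsDSIC.measurable_indicator_alloc (hM : M.IsDSIC) (i : Fin (m + 1)) :
    Measurable ({v : Fin (m + 1) → ℝ | v i = 1}.indicator
      fun v => ENNReal.ofReal (M.alloc v i)) :=
  (hM.measurable_alloc_apply i).ennreal_ofReal.indicator
    (measurableSet_eq_fun (measurable_pi_apply i) measurable_const)

/-- The probability of selling to a buyer with valuation `1` is at most that of `max(v) = 1`. -/
lemma Mechanism.IsDSIC.sum_lintegral_indicator_le (hM : M.IsDSIC)
    (hF : ∀ᵐ v ∂F, v ∈ Valuations (m + 1)) :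
    ∑ i, ∫⁻ v, {v : Fin (m + 1) → ℝ | v i = 1}.indicator
      (fun v => ENNReal.ofReal (M.alloc v i)) v ∂F ≤ F {v | maxVal v = 1} := by
  rw [← lintegral_finsetSum _ fun i _ => hM.measurable_indicator_alloc i,
    ← lintegral_indicator_one measurableSet_maxVal_eq_one]
  refine lintegral_mono_ae (hF.mono fun v hv => ?_)
  by_cases hmax : maxVal v = 1
  · rw [indicator_of_mem (show v ∈ {v | maxVal v = 1} from hmax), Pi.one_apply]
    calc _ ≤ ∑ i, ENNReal.ofReal (M.alloc v i) :=
          Finset.sum_le_sum fun i _ => indicator_le_self _ _ v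
      _ = ENNReal.ofReal (∑ i, M.alloc v i) :=
          (ENNReal.ofReal_sum_of_nonneg fun i _ => (hM.alloc_mem v hv i).1).symm
      _ ≤ 1 := by simpa using hM.ac v hv
  · rw [Finset.sum_eq_zero]
    · exact zero_le
    · intro i _
      refine indicator_of_notMem (fun hi => hmax ?_) _
      have hi' : v i = 1 := hi
      exact le_antisymm (maxVal_le_one hv) (hi' ▸ le_maxVal v i)

variable {τ : (Fin (m + 1) → ℝ) → Fin (m + 1) → ℝ} {Ψ : Measure ℝ} [IsProbabilityMeasure Ψ]

/-- A second-price auction whose reserve price is at most `1` sells whenever `max(v) = 1`. -/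
lemma le_sum_lintegral_indicator_spa (hτ : IsTieBreaking τ) (hΨ1 : Ψ.real (Iic 1) = 1) :
    F {v | maxVal v = 1} ≤ ∑ i, ∫⁻ v, {v : Fin (m + 1) → ℝ | v i = 1}.indicator
      (fun v => ENNReal.ofReal ((spa τ Ψ).alloc v i)) v ∂F := by
  have hM : (spa τ Ψ).IsDSIC := spa_mem_dsicMechanisms Ψ hτ
  rw [← lintegral_finsetSum _ fun i _ => hM.measurable_indicator_alloc i,
    ← lintegral_indicator_one measurableSet_maxVal_eq_one]
  refine lintegral_mono fun v => ?_
  by_cases hmax : maxVal v = 1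
  · rw [indicator_of_mem (show v ∈ {v | maxVal v = 1} from hmax), Pi.one_apply]
    have : ∀ i ∈ Finset.univ, {v : Fin (m + 1) → ℝ | v i = 1}.indicator
        (fun v => ENNReal.ofReal ((spa τ Ψ).alloc v i)) v = ENNReal.ofReal (τ v i) := by
      intro i _
      by_cases hi : v i = 1
      · rw [indicator_of_mem (show v ∈ {v : Fin (m + 1) → ℝ | v i = 1} from hi)]
        simp [spa, hmax, hΨ1]
      · rw [indicator_of_notMem (show v ∉ {v : Fin (m + 1) → ℝ | v i = 1} from hi),
          hτ.highest v i (by rwa [hmax]), ENNReal.ofReal_zero]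
    rw [Finset.sum_congr rfl this, ← ENNReal.ofReal_sum_of_nonneg fun i _ => hτ.nonneg v i,
      hτ.sum_eq_one, ENNReal.ofReal_one]
  · rw [indicator_of_notMem (show v ∉ {v | maxVal v = 1} from hmax)]
    exact zero_le

/-- Reserve prices above `r` leave no utility to a buyer with valuation `r`. -/
lemma spa_utility_update_le_zero (hτ : IsTieBreaking τ) (hΨr : Ψ.real (Iic r) = 0)
    (v : Fin (m + 1) → ℝ) (i : Fin (m + 1)) :
    (spa τ Ψ).utility (Function.update v i r) i ≤ 0 := by
  have hae : ∀ᵐ p ∂Ψ, r < p := by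
    rw [ae_iff]
    have : {p : ℝ | ¬ r < p} = Iic r := by ext; simp
    rw [this]
    exact (measureReal_eq_zero_iff).1 hΨr
  rw [Mechanism.utility]
  refine (spa_utility_le Ψ hτ _ i _).trans (le_of_eq ?_)
  refine integral_eq_zero_of_ae (hae.mono fun p hp => ?_)
  rw [Function.update_self]
  exact max_eq_right (sub_nonpos.2 (hp.le.trans (le_max_right _ _)))

lemma regret_spa_le_regret (hτ : IsTieBreaking τ) (hr : 0 < r) (hr1 : r < 1)
    (hΨr : Ψ.real (Iic r) = 0) (hΨ1 : Ψ.real (Iic 1) = 1) (hM : M ∈ dsicMechanisms (m + 1)) :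
    regret (spa τ Ψ) (Measure.pi fun _ => isoMeasure r)
      ≤ regret M (Measure.pi fun _ => isoMeasure r) := by
  have := isProbabilityMeasure_isoMeasure hr hr1
  have hae := ae_mem_valuations_of_mem_affClass
    (iidClass_subset_affClass _ (pi_isoMeasure_mem_iidClass (m + 1) hr hr1))
  have h1 := Mechanism.IsDSIC.regret_add_eq (spa_mem_dsicMechanisms Ψ hτ) hr hr1
  have h2 := Mechanism.IsDSIC.regret_add_eq hM hr hr1
  have h3 := Mechanism.IsDSIC.sum_lintegral_indicator_le hM hae
  have h4 := le_sum_lintegral_indicator_spa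
    (F := Measure.pi fun _ : Fin (m + 1) => isoMeasure r) hτ hΨ1
  rw [Finset.sum_eq_zero, add_zero] at h1
  · refine (ENNReal.add_le_add_iff_right (measure_ne_top
      (Measure.pi fun _ : Fin (m + 1) => isoMeasure r) {v | maxVal v = 1})).1 ?_
    calc _ ≤ _ := add_le_add le_rfl h4
      _ = _ := h1.symm
      _ ≤ _ := le_self_add
      _ = _ := h2
      _ ≤ _ := add_le_add le_rfl h3
  · intro i _
    rw [lintegral_congr (g := fun _ => 0), lintegral_zero]
    exact fun v => ENNReal.ofReal_of_nonpos (spa_utility_update_le_zero hτ hΨr v i)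

end Mechanism

/-! ### Affiliation bounds the second-highest bid -/

section LowerEvents

variable {n : ℕ} {F : Measure (Fin n → ℝ)}

/-- The probability that the bids of the buyers in `s` are at most `t`. -/
noncomputable def lowProb (F : Measure (Fin n → ℝ)) (t : ℝ) (s : Finset (Fin n)) : ℝ :=
  F.real {v | ∀ k ∈ s, v k ≤ t}

lemma measurableSet_forall_le (t : ℝ) (s : Finset (Fin n)) :
    MeasurableSet {v : Fin n → ℝ | ∀ k ∈ s, v k ≤ t} := by
  have : {v : Fin n → ℝ | ∀ k ∈ s, v k ≤ t} = ⋂ k ∈ s, {v : Fin n → ℝ | v k ≤ t} := by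
    ext v
    simp
  rw [this]
  exact s.measurableSet_biInter fun k _ =>
    measurableSet_le (measurable_pi_apply k) measurable_const

lemma isLowerSet_forall_le (t : ℝ) (s : Finset (Fin n)) :
    IsLowerSet {v : Fin n → ℝ | ∀ k ∈ s, v k ≤ t} :=
  fun _ _ hvw hv k hk => (hvw k).trans (hv k hk)

lemma isSublattice_forall_le (t : ℝ) (s : Finset (Fin n)) :
    IsSublattice {v : Fin n → ℝ | ∀ k ∈ s, v k ≤ t} where
  supClosed _ hv _ hw k hk := sup_le (hv k hk) (hw k hk)
  infClosed _ hv _ _ k hk := inf_le_left.trans (hv k hk)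

lemma lowProb_pi (G : Measure ℝ) [IsProbabilityMeasure G] (t : ℝ) (s : Finset (Fin n)) :
    lowProb (Measure.pi fun _ : Fin n => G) t s = G.real (Iic t) ^ s.card := by
  classical
  have : {v : Fin n → ℝ | ∀ k ∈ s, v k ≤ t} = univ.pi fun k => if k ∈ s then Iic t else univ := by
    ext v
    simp only [mem_ofPred_eq, mem_univ_pi]
    refine forall_congr' fun k => ?_
    split_ifs with hk <;> simp [hk]
  rw [lowProb, this, measureReal_def, Measure.pi_pi, measureReal_def, ← ENNReal.toReal_pow]
  congr 1
  have h : ∀ k : Fin n, G (if k ∈ s then Iic t else univ) = if k ∈ s then G (Iic t) else 1 := by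
    intro k
    split_ifs <;> simp
  simp [h]

/-- Exchangeability: only the number of buyers matters. -/
lemma Exchangeable.lowProb_insert_eq (hF : Exchangeable F) (t : ℝ) {s : Finset (Fin n)}
    {i j : Fin n} (hi : i ∉ s) (hj : j ∉ s) :
    lowProb F t (insert i s) = lowProb F t (insert j s) := by
  have hms := measurableSet_forall_le t (insert i s)
  rw [lowProb, lowProb, measureReal_def, measureReal_def]
  congr 1
  conv_lhs => rw [← hF (Equiv.swap i j)]
  rw [Measure.map_apply (by fun_prop) hms]
  congr 1
  ext v
  have hs : ∀ k ∈ s, Equiv.swap i j k = k := fun k hk =>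
    Equiv.swap_apply_of_ne_of_ne (by rintro rfl; exact hi hk) (by rintro rfl; exact hj hk)
  simp only [mem_preimage, mem_ofPred_eq, Finset.forall_mem_insert, Function.comp_apply,
    Equiv.swap_apply_left]
  refine and_congr_right fun _ => forall₂_congr fun k hk => ?_
  rw [hs k hk]

/-- Under affiliation decreasing events are positively correlated as well. -/
lemma Affiliated.mul_le_of_isLowerSet [IsFiniteMeasure F] (hF : Affiliated F)
    {A B S : Set (Fin n → ℝ)} (hA : MeasurableSet A) (hB : MeasurableSet B)
    (hS : MeasurableSet S) (hAl : IsLowerSet A) (hBl : IsLowerSet B) (hSl : IsSublattice S) :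
    F.real (S ∩ A) * F.real (S ∩ B) ≤ F.real S * F.real (S ∩ (A ∩ B)) := by
  have h := (affiliated_iff F).1 hF Aᶜ Bᶜ S hA.compl hB.compl hS hAl.compl hBl.compl hSl
  have h' : F.real (S ∩ Aᶜ) * F.real (S ∩ Bᶜ) ≤ F.real S * F.real (S ∩ (Aᶜ ∩ Bᶜ)) := by
    simp only [measureReal_def, ← ENNReal.toReal_mul]
    exact ENNReal.toReal_mono (ENNReal.mul_ne_top (measure_ne_top _ _) (measure_ne_top _ _)) h
  have e1 : F.real (S ∩ A) + F.real (S ∩ Aᶜ) = F.real S := by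
    rw [← sdiff_eq, measureReal_inter_add_sdiff hA]
  have e2 : F.real (S ∩ B) + F.real (S ∩ Bᶜ) = F.real S := by
    rw [← sdiff_eq, measureReal_inter_add_sdiff hB]
  have e3 : F.real (S ∩ (A ∩ B)) + F.real (S ∩ A ∩ Bᶜ) = F.real (S ∩ A) := by
    rw [← sdiff_eq, ← inter_assoc, measureReal_inter_add_sdiff hB]
  have e4 : F.real (S ∩ A ∩ Bᶜ) + F.real (S ∩ (Aᶜ ∩ Bᶜ)) = F.real (S ∩ Bᶜ) := by
    have h1 : S ∩ A ∩ Bᶜ = S ∩ Bᶜ ∩ A := inter_right_comm _ _ _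
    have h2 : S ∩ (Aᶜ ∩ Bᶜ) = (S ∩ Bᶜ) \ A := by
      rw [sdiff_eq, inter_comm Aᶜ, inter_assoc]
    rw [h1, h2, measureReal_inter_add_sdiff hA]
  have e5 : F.real (S ∩ (Aᶜ ∩ Bᶜ))
      = F.real S - F.real (S ∩ A) - F.real (S ∩ B) + F.real (S ∩ (A ∩ B)) := by linarith
  rw [e5, eq_sub_of_add_eq' e1, eq_sub_of_add_eq' e2] at h'
  linarith

/-- The conditional probability that one more bid is low, given that the bids of the buyers in a
set are low, is smallest for small sets: given low bids in `s`, a low bid of buyer `i₀` and low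
bids of all the others are positively correlated. Multiplying these comparisons over a growing set
of buyers bounds the probability that all of `s` bid low. -/
lemma pow_mul_lowProb_le [IsProbabilityMeasure F] (hE : Exchangeable F) (hA : Affiliated F)
    (t : ℝ) (i₀ : Fin n) (s : Finset (Fin n)) (hs : s ⊆ Finset.univ.erase i₀) :
    lowProb F t (Finset.univ.erase i₀) ^ s.card * lowProb F t s
      ≤ lowProb F t Finset.univ ^ s.card := by
  classical
  induction s using Finset.induction_on with
  | empty => simp [lowProb]
  | insert j s hj ih =>
    have hs' : s ⊆ Finset.univ.erase i₀ := (Finset.subset_insert j s).trans hs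
    have hi₀ : i₀ ∉ s := fun h => by simpa using hs' h
    have key := hA.mul_le_of_isLowerSet (measurableSet_forall_le t {i₀})
      (measurableSet_forall_le t (Finset.univ.erase i₀)) (measurableSet_forall_le t s)
      (isLowerSet_forall_le t _) (isLowerSet_forall_le t _) (isSublattice_forall_le t s)
    have e1 : {v : Fin n → ℝ | ∀ k ∈ s, v k ≤ t} ∩ {v | ∀ k ∈ ({i₀} : Finset (Fin n)), v k ≤ t}
        = {v | ∀ k ∈ insert i₀ s, v k ≤ t} := by
      ext v
      simp [and_comm]
    have e2 : {v : Fin n → ℝ | ∀ k ∈ s, v k ≤ t} ∩ {v | ∀ k ∈ Finset.univ.erase i₀, v k ≤ t}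
        = {v | ∀ k ∈ Finset.univ.erase i₀, v k ≤ t} :=
      inter_eq_right.2 fun v hv k hk => hv k (hs' hk)
    have e3 : {v : Fin n → ℝ | ∀ k ∈ s, v k ≤ t} ∩ ({v | ∀ k ∈ ({i₀} : Finset (Fin n)), v k ≤ t} ∩
        {v | ∀ k ∈ Finset.univ.erase i₀, v k ≤ t}) = {v | ∀ k ∈ Finset.univ, v k ≤ t} := by
      ext v
      simp only [mem_inter_iff, mem_ofPred_eq, Finset.mem_singleton, forall_eq, Finset.mem_erase,
        Finset.mem_univ, and_true, true_imp_iff]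
      refine ⟨fun h k => ?_, fun h => ⟨fun k _ => h k, h i₀, fun k _ => h k⟩⟩
      rcases eq_or_ne k i₀ with rfl | hk
      · exact h.2.1
      · exact h.2.2 k hk
    rw [e1, e2, e3] at key
    change lowProb F t (insert i₀ s) * lowProb F t (Finset.univ.erase i₀)
      ≤ lowProb F t s * lowProb F t Finset.univ at key
    rw [hE.lowProb_insert_eq t hi₀ hj] at key
    rw [Finset.card_insert_of_notMem hj, pow_succ, pow_succ]
    have hd : 0 ≤ lowProb F t (Finset.univ.erase i₀) ^ s.card := pow_nonneg measureReal_nonneg _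
    have ha : 0 ≤ lowProb F t Finset.univ := measureReal_nonneg
    calc _ = lowProb F t (Finset.univ.erase i₀) ^ s.card *
          (lowProb F t (insert j s) * lowProb F t (Finset.univ.erase i₀)) := by ring
      _ ≤ lowProb F t (Finset.univ.erase i₀) ^ s.card *
          (lowProb F t s * lowProb F t Finset.univ) := mul_le_mul_of_nonneg_left key hd
      _ = lowProb F t (Finset.univ.erase i₀) ^ s.card * lowProb F t s
          * lowProb F t Finset.univ := by ring
      _ ≤ _ := mul_le_mul_of_nonneg_right (ih hs') ha

end LowerEvents

/-- Young's inequality in the form in which `d ≤ a ^ (m / (m + 1))` is used. -/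
lemma succ_mul_mul_le {m : ℕ} {q d a : ℝ} (hq : 0 ≤ q) (ha : 0 ≤ a)
    (h : d ^ (m + 1) ≤ a ^ m) : ((m : ℝ) + 1) * (q * d) ≤ q ^ (m + 1) + m * a := by
  obtain ⟨y, hy, rfl⟩ : ∃ y : ℝ, 0 ≤ y ∧ y ^ (m + 1) = a :=
    ⟨a ^ ((m + 1 : ℕ) : ℝ)⁻¹, by positivity, Real.rpow_inv_natCast_pow ha (Nat.succ_ne_zero m)⟩
  have hdy : d ≤ y ^ m := by
    rw [← pow_mul, mul_comm, pow_mul] at h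
    exact le_of_pow_le_pow_left₀ (Nat.succ_ne_zero m) (pow_nonneg hy m) h
  have hqy : ((m : ℝ) + 1) * (q * y ^ m) ≤ q ^ (m + 1) + m * y ^ (m + 1) := by
    rcases hy.eq_or_lt with rfl | hy
    · rcases m with _ | k
      · simp
      · simp
        positivity
    · have hb := one_add_mul_sub_le_pow (a := q / y)
        (by linarith [div_nonneg hq hy.le] : -1 ≤ q / y) (m + 1)
      rw [div_pow, le_div_iff₀ (by positivity)] at hb
      have e : (1 + ((m + 1 : ℕ) : ℝ) * (q / y - 1)) * y ^ (m + 1)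
          = ((m : ℝ) + 1) * (q * y ^ m) - m * y ^ (m + 1) := by
        push_cast
        field_simp
        ring
      linarith
  refine le_trans ?_ hqy
  gcongr

lemma lowProb_pow_le {m : ℕ} {F : Measure (Fin (m + 1) → ℝ)} (hF : F ∈ affClass (m + 1)) (t : ℝ) :
    lowProb F t (Finset.univ.erase 0) ^ (m + 1) ≤ lowProb F t Finset.univ ^ m := by
  have := hF.1
  have h := pow_mul_lowProb_le hF.2.2.1 hF.2.2.2 t 0 (Finset.univ.erase 0) subset_rfl
  have hc : (Finset.univ.erase (0 : Fin (m + 1))).card = m := by simp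
  rwa [hc, ← pow_succ] at h

/-! ### A layer-cake formula for the regret of the auction -/

section LayerCake

variable {m : ℕ} {r : ℝ} {Ψ : Measure ℝ} [IsProbabilityMeasure Ψ]

/-- Fubini for `M - max (s, p) = ∫_s^M 1{p ≤ t} dt`. -/
lemma setIntegral_max_eq (Ψ : Measure ℝ) [IsProbabilityMeasure Ψ] {s M : ℝ} (hs : s ≤ M) :
    ∫ p in Iic M, max s p ∂Ψ
      = M * Ψ.real (Iic M) - ∫ t in Ico s M, Ψ.real (Iic t) := by
  have h1 : ∫ p in Iic M, (M - max s p) ∂Ψ = M * Ψ.real (Iic M) - ∫ p in Iic M, max s p ∂Ψ := by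
    rw [integral_sub (integrable_const _) (integrableOn_max Ψ _ _), setIntegral_const, smul_eq_mul,
      mul_comm]
  have h2 : ∀ p ∈ Iic M, M - max s p = ∫ t in Ico s M, (Ici p).indicator (fun _ => (1 : ℝ)) t := by
    intro p hp
    rw [setIntegral_indicator measurableSet_Ici, setIntegral_const]
    have : Ico s M ∩ Ici p = Ico (max s p) M := by
      ext t
      simp only [mem_inter_iff, mem_Ico, mem_Ici, max_le_iff]
      tauto
    rw [this, Real.volume_real_Ico_of_le (max_le hs hp)]
    simp
  have h3 : ∀ t ∈ Ico s M, ∫ p in Iic M, (Ici p).indicator (fun _ => (1 : ℝ)) t ∂Ψ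
      = Ψ.real (Iic t) := by
    intro t ht
    have : (fun p : ℝ => (Ici p).indicator (fun _ => (1 : ℝ)) t) = (Iic t).indicator 1 := by
      funext p
      simp [indicator]
    rw [this, integral_indicator_one measurableSet_Iic,
      measureReal_restrict_apply measurableSet_Iic,
      inter_eq_left.2 (Iic_subset_Iic.2 ht.2.le)]
  have hint : Integrable (Function.uncurry fun p t : ℝ => (Ici p).indicator (fun _ => (1 : ℝ)) t)
      ((Ψ.restrict (Iic M)).prod (volume.restrict (Ico s M))) := by
    have : (Function.uncurry fun p t : ℝ => (Ici p).indicator (fun _ => (1 : ℝ)) t)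
        = {z : ℝ × ℝ | z.1 ≤ z.2}.indicator fun _ => 1 := by
      funext z
      simp [indicator, Function.uncurry]
    rw [this]
    exact (integrable_const 1).indicator (measurableSet_le measurable_fst measurable_snd)
  rw [setIntegral_congr_fun measurableSet_Iic h2, integral_integral_swap hint,
    setIntegral_congr_fun measurableSet_Ico h3] at h1
  linarith

/-- The integrand of the layer-cake formula, at the level `t` and the bid vector `v`. -/
noncomputable def layer (m : ℕ) (r t : ℝ) (v : Fin (m + 1) → ℝ) : ℝ :=
  {v | t < maxVal v}.indicator (fun _ => lossDensity m r t) v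
    + {v | secondVal v ≤ t ∧ t < maxVal v}.indicator (fun _ => reserveCDF (m + 1) r t) v

lemma maxVal_sub_revenue_eq (h : IsOptimalLevel (m + 1) r)
    (hΨ : ∀ t, Ψ.real (Iic t) = reserveCDF (m + 1) r t) {v : Fin (m + 1) → ℝ}
    (hv : v ∈ Valuations (m + 1)) :
    maxVal v - ∫ p in Iic (maxVal v), max (secondVal v) p ∂Ψ = ∫ t in Ico 0 1, layer m r t v := by
  have hM0 := maxVal_nonneg hv
  have hM1 := maxVal_le_one hv
  have hs0 := secondVal_nonneg hv
  have hsM := secondVal_le_maxVal hv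
  have e1 : ∀ t, layer m r t v = (Iio (maxVal v)).indicator (lossDensity m r) t
      + (Ico (secondVal v) (maxVal v)).indicator (reserveCDF (m + 1) r) t := by
    intro t
    simp [layer, indicator]
  have i1 : IntegrableOn ((Iio (maxVal v)).indicator (lossDensity m r)) (Ico 0 1) := by
    refine Integrable.indicator ?_ measurableSet_Iio
    exact (integrableOn_congr_set_ae Ico_ae_eq_Ioc).2 (integrableOn_lossDensity h 0 1)
  have i2 : IntegrableOn ((Ico (secondVal v) (maxVal v)).indicator (reserveCDF (m + 1) r))
      (Ico 0 1) := by
    refine Integrable.indicator ?_ measurableSet_Ico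
    exact (continuous_reserveCDF h).integrableOn_Icc.mono_set Ico_subset_Icc_self
  have s1 : Ico 0 1 ∩ Iio (maxVal v) = Ico 0 (maxVal v) := by
    ext t
    simp only [mem_inter_iff, mem_Ico, mem_Iio]
    exact ⟨fun ht => ⟨ht.1.1, ht.2⟩, fun ht => ⟨⟨ht.1, ht.2.trans_le hM1⟩, ht.2⟩⟩
  have s2 : Ico 0 1 ∩ Ico (secondVal v) (maxVal v) = Ico (secondVal v) (maxVal v) :=
    inter_eq_right.2 (Ico_subset_Ico hs0 hM1)
  simp only [e1]
  rw [integral_add i1 i2, setIntegral_indicator measurableSet_Iio,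
    setIntegral_indicator measurableSet_Ico, s1, s2, integral_lossDensity h hM0 hM1,
    setIntegral_max_eq Ψ hsM]
  simp only [hΨ]
  ring

lemma measurable_layer (h : IsOptimalLevel (m + 1) r) :
    Measurable fun z : (Fin (m + 1) → ℝ) × ℝ => layer m r z.2 z.1 := by
  have hmax : Measurable fun z : (Fin (m + 1) → ℝ) × ℝ => maxVal z.1 :=
    measurable_maxVal.comp measurable_fst
  have hsec : Measurable fun z : (Fin (m + 1) → ℝ) × ℝ => secondVal z.1 :=
    measurable_secondVal.comp measurable_fst
  have h1 := ((measurable_lossDensity h).comp measurable_snd).indicator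
    (measurableSet_lt measurable_snd hmax)
  have h2 := ((continuous_reserveCDF h).measurable.comp measurable_snd).indicator
    ((measurableSet_le hsec measurable_snd).inter (measurableSet_lt measurable_snd hmax))
  exact h1.add h2

lemma abs_layer_le (h : IsOptimalLevel (m + 1) r) (t : ℝ) (v : Fin (m + 1) → ℝ) :
    |layer m r t v| ≤ 2 := by
  have h1 := abs_lossDensity_le_one h t
  have h2 : |reserveCDF (m + 1) r t| ≤ 1 := by
    have := reserveCDF_mem_Icc h t
    rw [abs_of_nonneg this.1]
    exact this.2
  have h3 := norm_indicator_le_norm_self (s := {v : Fin (m + 1) → ℝ | t < maxVal v})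
    (fun _ => lossDensity m r t) v
  have h4 := norm_indicator_le_norm_self
    (s := {v : Fin (m + 1) → ℝ | secondVal v ≤ t ∧ t < maxVal v})
    (fun _ => reserveCDF (m + 1) r t) v
  rw [Real.norm_eq_abs, Real.norm_eq_abs] at h3 h4
  exact (abs_add_le _ _).trans (by linarith)

variable {F : Measure (Fin (m + 1) → ℝ)}

lemma integrable_layer [IsProbabilityMeasure F] (h : IsOptimalLevel (m + 1) r) :
    Integrable (Function.uncurry fun v t => layer m r t v)
      (F.prod (volume.restrict (Ico (0 : ℝ) 1))) :=
  Integrable.of_bound (C := 2) (measurable_layer h).aestronglyMeasurable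
    (Eventually.of_forall fun z => abs_layer_le h z.2 z.1)

/-- For `t ≥ 0` the event `v⁽²⁾ ≤ t` includes the case of a single buyer, whose second bid is
`0`. -/
lemma secondVal_le_iff_of_nonneg (v : Fin (m + 1) → ℝ) {t : ℝ} (ht : 0 ≤ t) :
    secondVal v ≤ t ↔ ∃ i, ∀ j, j ≠ i → v j ≤ t := by
  rcases Nat.eq_zero_or_pos m with rfl | hm
  · have h0 : secondVal v = 0 := by simp [secondVal]
    rw [h0]
    exact iff_of_true ht ⟨0, fun j hj => absurd (Subsingleton.elim (α := Fin 1) j 0) hj⟩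
  · exact secondVal_le_iff v hm

lemma measureReal_lt_maxVal [IsProbabilityMeasure F] (t : ℝ) :
    F.real {v | t < maxVal v} = 1 - lowProb F t Finset.univ := by
  have : {v : Fin (m + 1) → ℝ | t < maxVal v} = {v | ∀ k ∈ Finset.univ, v k ≤ t}ᶜ := by
    ext v
    rw [mem_compl_iff, mem_ofPred_eq, mem_ofPred_eq, ← not_le, maxVal_le_iff]
    simp
  rw [this, probReal_compl_eq_one_sub (measurableSet_forall_le t _)]
  rfl

/-- Exactly one of the bids exceeds `t`; by exchangeability each buyer is equally likely to have
placed it. -/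
lemma measureReal_secondVal_le_lt_maxVal [IsProbabilityMeasure F] (hE : Exchangeable F) {t : ℝ}
    (ht : 0 ≤ t) :
    F.real {v | secondVal v ≤ t ∧ t < maxVal v}
      = ((m : ℝ) + 1) * (lowProb F t (Finset.univ.erase 0) - lowProb F t Finset.univ) := by
  set E : Fin (m + 1) → Set (Fin (m + 1) → ℝ) := fun i =>
    {v | ∀ k ∈ Finset.univ.erase i, v k ≤ t} \ {v | ∀ k ∈ Finset.univ, v k ≤ t} with hEdef
  have hEm : ∀ i, MeasurableSet (E i) := fun i =>
    (measurableSet_forall_le t _).diff (measurableSet_forall_le t _)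
  have hunion : {v : Fin (m + 1) → ℝ | secondVal v ≤ t ∧ t < maxVal v} = ⋃ i, E i := by
    ext v
    simp only [hEdef, mem_ofPred_eq, mem_iUnion, Set.mem_sdiff, Finset.mem_erase, Finset.mem_univ,
      and_true, true_imp_iff, exists_and_right]
    rw [secondVal_le_iff_of_nonneg v ht, ← not_le, maxVal_le_iff]
  have hdisj : Pairwise (Function.onFun Disjoint E) := by
    intro i k hik
    rw [Function.onFun, Set.disjoint_left]
    rintro v ⟨hi, hall⟩ ⟨hk, -⟩
    refine hall fun j _ => ?_
    rcases eq_or_ne j i with rfl | hj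
    · exact hk j (by simpa using hik)
    · exact hi j (by simpa using hj)
  have hE0 : ∀ i, F.real (E i)
      = lowProb F t (Finset.univ.erase 0) - lowProb F t Finset.univ := by
    intro i
    have hsub : {v : Fin (m + 1) → ℝ | ∀ k ∈ Finset.univ, v k ≤ t}
        ⊆ {v | ∀ k ∈ Finset.univ.erase i, v k ≤ t} := fun v hv k _ => hv k (Finset.mem_univ k)
    rw [hEdef, measureReal_sdiff hsub (measurableSet_forall_le t _)]
    change lowProb F t (Finset.univ.erase i) - lowProb F t Finset.univ = _
    congr 1
    rcases eq_or_ne i 0 with rfl | hi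
    · rfl
    · have e1 : Finset.univ.erase i = insert 0 ((Finset.univ.erase i).erase 0) :=
        (Finset.insert_erase (by simpa using hi.symm)).symm
      have e2 : Finset.univ.erase 0 = insert i ((Finset.univ.erase i).erase 0) := by
        rw [Finset.erase_right_comm, Finset.insert_erase (by simpa using hi)]
      rw [e1, e2]
      exact hE.lowProb_insert_eq t (by simp) (by simp)
  rw [hunion, measureReal_iUnion_fintype hdisj hEm, Finset.sum_congr rfl fun i _ => hE0 i]
  simp only [Finset.sum_const, Finset.card_univ, Fintype.card_fin, nsmul_eq_mul]
  push_cast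
  ring

lemma integral_layer [IsProbabilityMeasure F] (hE : Exchangeable F) {t : ℝ} (ht : 0 ≤ t) :
    ∫ v, layer m r t v ∂F
      = lossDensity m r t * (1 - lowProb F t Finset.univ)
        + reserveCDF (m + 1) r t * (((m : ℝ) + 1) *
          (lowProb F t (Finset.univ.erase 0) - lowProb F t Finset.univ)) := by
  have m1 : MeasurableSet {v : Fin (m + 1) → ℝ | t < maxVal v} :=
    measurableSet_lt measurable_const measurable_maxVal
  have m2 : MeasurableSet {v : Fin (m + 1) → ℝ | secondVal v ≤ t ∧ t < maxVal v} :=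
    (measurableSet_le measurable_secondVal measurable_const).inter m1
  unfold layer
  rw [integral_add ((integrable_const _).indicator m1) ((integrable_const _).indicator m2),
    integral_indicator_const _ m1, integral_indicator_const _ m2, measureReal_lt_maxVal,
    measureReal_secondVal_le_lt_maxVal hE ht, smul_eq_mul, smul_eq_mul]
  ring

variable {τ : (Fin (m + 1) → ℝ) → Fin (m + 1) → ℝ}

lemma regret_spa_eq (hτ : IsTieBreaking τ) (h : IsOptimalLevel (m + 1) r)
    (hΨ : ∀ t, Ψ.real (Iic t) = reserveCDF (m + 1) r t) (hF : F ∈ affClass (m + 1)) :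
    regret (spa τ Ψ) F = ENNReal.ofReal (∫ t in Ico 0 1, ∫ v, layer m r t v ∂F) := by
  have := hF.1
  have hae := ae_mem_valuations_of_mem_affClass hF
  have hM : (spa τ Ψ).IsDSIC := spa_mem_dsicMechanisms Ψ hτ
  have hrev : ∀ v ∈ Valuations (m + 1), maxVal v - ∑ i, (spa τ Ψ).pay v i
      = ∫ t in Ico 0 1, layer m r t v := by
    intro v hv
    rw [← maxVal_sub_revenue_eq h hΨ hv]
    simp only [spa]
    rw [← Finset.sum_mul, hτ.sum_eq_one, one_mul]
  have hnn : ∀ v ∈ Valuations (m + 1), 0 ≤ maxVal v - ∑ i, (spa τ Ψ).pay v i := by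
    intro v hv
    have h1 := hM.sum_mul_alloc_le hv
    have h2 : ∑ i, (spa τ Ψ).pay v i ≤ ∑ i, v i * (spa τ Ψ).alloc v i :=
      Finset.sum_le_sum fun i _ => sub_nonneg.1 (hM.ir v hv i)
    linarith
  have hint : Integrable (fun v => ∫ t in Ico 0 1, layer m r t v) F :=
    (integrable_layer h).integral_prod_left
  rw [← integral_integral_swap (integrable_layer h), ofReal_integral_eq_lintegral_ofReal hint]
  · exact lintegral_congr_ae (hae.mono fun v hv => by simp only [hrev v hv])
  · exact hae.mono fun v hv => by
      simp only [Pi.zero_apply, ← hrev v hv]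
      exact hnn v hv

/-- At every level isorevenue bids are the worst case. Above `r` the probabilities `a` and `d` that
all bids, respectively all but one, are at most `t` enter through `(m + 1) q d - m a`, which is at
most `q ^ (m + 1)`, with equality for i.i.d. isorevenue bids. Up to `r` the layer is `1 - a`, and
isorevenue bids have `a = 0`. -/
lemma integral_layer_le (h : IsOptimalLevel (m + 1) r) (hF : F ∈ affClass (m + 1)) {t : ℝ}
    (ht : t ∈ Ico (0 : ℝ) 1) :
    ∫ v, layer m r t v ∂F ≤ ∫ v, layer m r t v ∂(Measure.pi fun _ => isoMeasure r) := by
  have := hF.1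
  have := isProbabilityMeasure_isoMeasure h.1 h.lt_one
  have ha : 0 ≤ lowProb F t Finset.univ := measureReal_nonneg
  rw [integral_layer hF.2.2.1 ht.1, integral_layer (exchangeable_pi _ _) ht.1, lowProb_pi,
    lowProb_pi, ← cdf_eq_real, cdf_isoMeasure h.1 h.lt_one,
    show (Finset.univ.erase (0 : Fin (m + 1))).card = m by simp, Finset.card_univ, Fintype.card_fin]
  rcases le_or_gt t r with htr | htr
  · rw [reserveCDF_of_le htr, lossDensity, isorevenueCDF, if_pos htr, if_pos htr]
    simp [ha]
  · have ht0 : 0 < t := h.1.trans htr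
    have htr' : 0 < t - r := sub_pos.2 htr
    have hφ := (reserveCDF_mem_Icc h t).1
    rw [lossDensity, isorevenueCDF, if_neg (not_le.2 htr), if_neg (not_le.2 htr), if_pos ht.2]
    have hq0 : 0 < 1 - r / t := by rw [sub_pos, div_lt_one ht0]; exact htr
    have hq : r / (t - r) = 1 / (1 - r / t) - 1 := by field_simp; ring
    have key := succ_mul_mul_le hq0.le ha (lowProb_pow_le hF t)
    rw [mul_div_assoc, hq]
    generalize lowProb F t Finset.univ = a at *
    generalize lowProb F t (Finset.univ.erase 0) = d at *
    generalize 1 - r / t = q at *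
    generalize reserveCDF (m + 1) r t = φ at *
    have e : φ * (m * (1 / q - 1) - 1) * (1 - q ^ (m + 1))
          + φ * (((m : ℝ) + 1) * (q ^ m - q ^ (m + 1)))
        - (φ * (m * (1 / q - 1) - 1) * (1 - a) + φ * (((m : ℝ) + 1) * (d - a)))
        = φ / q * (q ^ (m + 1) + m * a - ((m : ℝ) + 1) * (q * d)) := by
      field_simp
      ring
    have := mul_nonneg (div_nonneg hφ hq0.le) (sub_nonneg.2 key)
    linarith

lemma regret_spa_le_regret_spa (hτ : IsTieBreaking τ) (h : IsOptimalLevel (m + 1) r)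
    (hΨ : ∀ t, Ψ.real (Iic t) = reserveCDF (m + 1) r t) (hF : F ∈ affClass (m + 1)) :
    regret (spa τ Ψ) F ≤ regret (spa τ Ψ) (Measure.pi fun _ => isoMeasure r) := by
  have hF' := iidClass_subset_affClass _ (pi_isoMeasure_mem_iidClass (m + 1) h.1 h.lt_one)
  have := hF.1
  have := isProbabilityMeasure_isoMeasure h.1 h.lt_one
  rw [regret_spa_eq hτ h hΨ hF, regret_spa_eq hτ h hΨ hF']
  refine ENNReal.ofReal_le_ofReal (setIntegral_mono_on (integrable_layer h).integral_prod_right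
    (integrable_layer h).integral_prod_right measurableSet_Ico fun t ht => ?_)
  exact integral_layer_le h hF ht

end LayerCake

/-! ### The saddle point -/

/-- A saddle point for the larger class whose distribution lies in the smaller class is one for
both. -/
lemma minimaxRegret_eq_of_saddle {n : ℕ} {C D : Set (Measure (Fin n → ℝ))} (hCD : D ⊆ C)
    {m₀ : Mechanism n} {F₀ : Measure (Fin n → ℝ)} (hm₀ : m₀ ∈ dsicMechanisms n) (hF₀ : F₀ ∈ D)
    (hleft : ∀ F ∈ C, regret m₀ F ≤ regret m₀ F₀)
    (hright : ∀ m ∈ dsicMechanisms n, regret m₀ F₀ ≤ regret m F₀) :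
    minimaxRegret n C = minimaxRegret n D := by
  apply le_antisymm
  · calc minimaxRegret n C ≤ ⨆ F ∈ C, regret m₀ F := iInf₂_le m₀ hm₀
      _ ≤ regret m₀ F₀ := iSup₂_le hleft
      _ ≤ minimaxRegret n D := le_iInf₂ fun m hm =>
          (hright m hm).trans (le_iSup₂ (f := fun F _ => regret m F) F₀ hF₀)
  · exact iInf₂_mono fun m _ => biSup_mono fun F hF => hCD hF

end RegretAuction

open RegretAuction in
theorem mainTheorem2 (n : ℕ) (hn : 1 ≤ n) :
    (∃ r : ℝ, IsOptimalLevel n r ∧ (∀ s : ℝ, IsOptimalLevel n s → s = r) ∧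
      ∃ Ψ G : Measure ℝ,
        IsProbabilityMeasure Ψ ∧ (∀ v : ℝ, cdf Ψ v = reserveCDF n r v) ∧
        IsProbabilityMeasure G ∧ (∀ v : ℝ, cdf G v = isorevenueCDF r v) ∧
        Measure.pi (fun _ : Fin n => G) ∈ iidClass n ∧
        Measure.pi (fun _ : Fin n => G) ∈ affClass n ∧
        ∀ τ : (Fin n → ℝ) → Fin n → ℝ, IsTieBreaking τ →
          spa τ Ψ ∈ dsicMechanisms n ∧
          (∀ F ∈ affClass n,
            regret (spa τ Ψ) F ≤ regret (spa τ Ψ) (Measure.pi (fun _ : Fin n => G))) ∧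
          (∀ m ∈ dsicMechanisms n,
            regret (spa τ Ψ) (Measure.pi (fun _ : Fin n => G))
              ≤ regret m (Measure.pi (fun _ : Fin n => G)))) ∧
    minimaxRegret n (affClass n) = minimaxRegret n (iidClass n) := by
  obtain ⟨m, rfl⟩ := Nat.exists_eq_add_of_le' hn
  obtain ⟨r, hr⟩ := exists_isOptimalLevel m
  obtain ⟨Ψ, hΨ, hcdf⟩ := exists_measure_cdf_eq_reserveCDF hr
  have hΨ' : ∀ t, Ψ.real (Set.Iic t) = reserveCDF (m + 1) r t := fun t => by
    rw [← cdf_eq_real, hcdf]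
  have hiid := pi_isoMeasure_mem_iidClass (m + 1) hr.1 hr.lt_one
  have hright : ∀ τ : (Fin (m + 1) → ℝ) → Fin (m + 1) → ℝ, IsTieBreaking τ →
      ∀ M ∈ dsicMechanisms (m + 1),
        regret (spa τ Ψ) (Measure.pi fun _ => isoMeasure r)
          ≤ regret M (Measure.pi fun _ => isoMeasure r) := fun τ hτ M hM =>
    regret_spa_le_regret hτ hr.1 hr.lt_one (by rw [hΨ', reserveCDF_of_le le_rfl])
      (by rw [hΨ', reserveCDF_one hr]) hM
  refine ⟨⟨r, hr, fun s hs => hr.unique hs, Ψ, isoMeasure r, hΨ, hcdf,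
    isProbabilityMeasure_isoMeasure hr.1 hr.lt_one, cdf_isoMeasure hr.1 hr.lt_one, hiid,
    iidClass_subset_affClass _ hiid, fun τ hτ => ⟨spa_mem_dsicMechanisms Ψ hτ,
      fun F hF => regret_spa_le_regret_spa hτ hr hΨ' hF, hright τ hτ⟩⟩, ?_⟩
  have hτ := isTieBreaking_uniformTieBreaking m
  exact minimaxRegret_eq_of_saddle (iidClass_subset_affClass _) (spa_mem_dsicMechanisms Ψ hτ) hiid
    (fun F hF => regret_spa_le_regret_spa hτ hr hΨ' hF) (hright _ hτ)
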